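/- Let $d\in\{2,3\}$, let $\Omega\subset\mathbb R^d$ be a bounded open set and let $\nu>0$. Put $V=[H^1_0(\Omega)]^d$ (the $H^1$-closure of $[C_c^\infty(\Omega)]^d$) with $\|v\|_V=\|\nabla v\|_{L^2(\Omega)}$, and $Q=L^2_0(\Omega)$ (mean-zero functions in $L^2(\Omega)$). Let $(\cdot,\cdot)$ be the $L^2$ inner product and $$a(u,v)=\nu(\nabla u,\nabla v),\qquad b(v,q)=-(\nabla\cdot v,q),\qquad \|f\|_{V'}=\sup_{0\ne v\in V}\frac{(f,v)}{\|v\|_V}.$$ There is a constant $C>0$, depending only on $d$, $\Omega$ and $\nu$, such that the following holds for every $f\in[L^2(\Omega)]^d$ and for all finite-dimensional subspaces $V_h\subset V$, $Q_h\subset Q$ (for instance Taylor–Hood finite element spaces) that satisfy the discrete inf-sup condition: for some $\beta_h>0$, $$\beta_h\le \inf_{0\ne q_h\in Q_h}\ \sup_{0\ne v_h\in V_h}\frac{|b(v_h,q_h)|}{\|v_h\|_V\|q_h\|_{L^2(\Omega)}}.$$ Set $\mathfrak u_h^0=f$ and, for $1\le i\le \ell$, let $(\mathfrak u_h^i,\mathfrak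 p_h^i)\in V_h\times Q_h$ satisfy $$a(\mathfrak u_h^i,v_h)+b(v_h,\mathfrak p_h^i)=(\mathfrak u_h^{i-1},v_h)\quad\forall v_h\in V_h,\qquad b(\mathfrak u_h^i,q_h)=0\quad\forall q_h\in Q_h .$$ Let $\varphi_1,\dots,\varphi_N$ be a basis of $V_h$, let $A_{ij}=a(\varphi_j,\varphi_i)$, let $1\le r\le\ell$ be such that $\mathfrak u_h^1,\dots,\mathfrak u_h^r$ are linearly independent, let $U_r\in\mathbb R^{N\times r}$ be the matrix whose $i$-th column is the coefficient vector of $\mathfrak u_h^i$ in this basis, and let $K_r=U_r^\top A U_r$. Then $K_r$ is a real symmetric Hankel matrix, its eigenvalues (with multiplicity) $\lambda_1(K_r)\ge\dots\ge\lambda_r(K_r)=\lambda_{\min}(K_r)$ are positive, $$\lambda_{2k+1}(K_r)\le 16\left[\exp\left(\frac{\pi^2}{4\log(8\lfloor r/2\rfloor/\pi)}\right)\right]^{-2k+2}\lambda_1(K_r)\qquad\text{for all integers } k\ge0 \text{ with } 2k+1\le r$$ (for $r=1$ the bracket is read as $1$), and $$\lambda_{\min}(K_r)\le C\,(2r-1)\,\|f\|_{V'}^2\,\exp\left(-\frac{7(r+1)}2\right).$$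 -/

import Mathlib

open MeasureTheory
open scoped ContDiff

noncomputable section

namespace StokesROM

variable {d : ℕ}

/-- `ℝ^d` with its Euclidean norm. -/
abbrev Pt (d : ℕ) := EuclideanSpace ℝ (Fin d)

/-- `[L²(Ω)]^d`. -/
abbrev L2Field (Ω : Set (Pt d)) := Lp (Pt d) 2 (volume.restrict Ω)

/-- `[L²(Ω)]^{d × d}` (pointwise Frobenius inner product), the home of velocity gradients. -/
abbrev L2Tensor (Ω : Set (Pt d)) :=
  Lp (EuclideanSpace ℝ (Fin d × Fin d)) 2 (volume.restrict Ω)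

/-- The Jacobian of a differentiable vector field; the entry `(i, j)` is `∂_j φ_i`. -/
def jacobian (φ : Pt d → Pt d) (x : Pt d) : EuclideanSpace ℝ (Fin d × Fin d) :=
  WithLp.toLp 2 fun ij => fderiv ℝ φ x (EuclideanSpace.single ij.2 1) ij.1

/-- All pairs `(φ, ∇φ)`, as elements of `L² × L²`, with `φ ∈ [C_c^∞(Ω)]^d`. -/
def testPairs (Ω : Set (Pt d)) : Set (L2Field Ω × L2Tensor Ω) :=
  {w | ∃ φ : Pt d → Pt d, ContDiff ℝ ∞ φ ∧ HasCompactSupport φ ∧ tsupport φ ⊆ Ω ∧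
    (w.1 : Pt d → Pt d) =ᵐ[volume.restrict Ω] φ ∧
    (w.2 : Pt d → EuclideanSpace ℝ (Fin d × Fin d)) =ᵐ[volume.restrict Ω] jacobian φ}

/-- `[H¹₀(Ω)]^d`, the closure of `[C_c^∞(Ω)]^d` in the `H¹` norm. A function `v` of the space is
represented by the pair `(v, ∇v)`; the second entry is the weak gradient of the first one, as a
limit in `L²` of gradients of test fields, so it is determined by `v`. -/
def H10 (Ω : Set (Pt d)) : Submodule ℝ (L2Field Ω × L2Tensor Ω) :=
  (Submodule.span ℝ (testPairs Ω)).topologicalClosure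

/-- The velocity space `V = [H¹₀(Ω)]^d`. -/
abbrev VelocitySpace (Ω : Set (Pt d)) := ↥(H10 Ω)

/-- The function underlying an element of `V`, in `[L²(Ω)]^d`. -/
def val {Ω : Set (Pt d)} (v : VelocitySpace Ω) : L2Field Ω := v.1.1

/-- The weak gradient of an element of `V`. -/
def grad {Ω : Set (Pt d)} (v : VelocitySpace Ω) : L2Tensor Ω := v.1.2

/-- `L²₀(Ω)`: the square integrable functions of mean zero. (On a set of finite measure the
integrability is automatic.) -/
def L20 (Ω : Set (Pt d)) : Submodule ℝ (Lp ℝ 2 (volume.restrict Ω)) where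
  carrier := {q | Integrable (q : Pt d → ℝ) (volume.restrict Ω) ∧ ∫ x in Ω, q x = 0}
  zero_mem' := by
    have h := Lp.coeFn_zero ℝ 2 (volume.restrict Ω)
    refine ⟨(integrable_zero _ _ _).congr h.symm, ?_⟩
    rw [integral_congr_ae h]
    simp
  add_mem' := by
    rintro p q ⟨hp, hp0⟩ ⟨hq, hq0⟩
    have h := Lp.coeFn_add p q
    refine ⟨(hp.add hq).congr h.symm, ?_⟩
    rw [integral_congr_ae h]
    simp [integral_add hp hq, hp0, hq0]
  smul_mem' := by
    rintro c q ⟨hq, hq0⟩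
    have h := Lp.coeFn_smul c q
    refine ⟨(hq.smul c).congr h.symm, ?_⟩
    rw [integral_congr_ae h]
    simp [integral_const_mul, hq0]

/-- The pressure space `Q = L²₀(Ω)`. -/
abbrev PressureSpace (Ω : Set (Pt d)) := ↥(L20 Ω)

/-- `‖v‖_V = ‖∇v‖_{L²(Ω)}`, the norm of `V = [H¹₀(Ω)]^d`. -/
def normV {Ω : Set (Pt d)} (v : VelocitySpace Ω) : ℝ := ‖grad v‖

/-- `‖f‖_{V'} = sup_{v ≠ 0} (f, v) / ‖v‖_V`. (The vector `v = 0` contributes the value `0`, which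
does not change the supremum.) -/
def dualNorm {Ω : Set (Pt d)} (f : L2Field Ω) : ℝ :=
  ⨆ v : VelocitySpace Ω, inner ℝ f (val v) / normV v

/-- `a(u, v) = ν (∇u, ∇v)`. -/
def formA {Ω : Set (Pt d)} (ν : ℝ) (u v : VelocitySpace Ω) : ℝ := ν * inner ℝ (grad u) (grad v)

/-- `b(v, q) = -(∇ · v, q)`. -/
def formB {Ω : Set (Pt d)} (v : VelocitySpace Ω) (q : PressureSpace Ω) : ℝ :=
  -∫ x in Ω, (∑ i, grad v x (i, i)) * q.1 x

/-- The discrete inf-sup condition: for some `β > 0`,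
`β ≤ inf_{q ∈ Q_h} sup_{v ∈ V_h} |b(v, q)| / (‖v‖_V ‖q‖)`. -/
def DiscreteInfSup {Ω : Set (Pt d)} (Vh : Submodule ℝ (VelocitySpace Ω))
    (Qh : Submodule ℝ (PressureSpace Ω)) : Prop :=
  ∃ β : ℝ, 0 < β ∧ ∀ q : Qh, β * ‖q‖ ≤ ⨆ v : Vh, |formB (v : VelocitySpace Ω) q| / normV v.1

/-- The load of the successive stationary Stokes problems: `f` for the first one, and afterwards
the preceding velocity. -/
def load {Ω : Set (Pt d)} {Vh : Submodule ℝ (VelocitySpace Ω)} (f : L2Field Ω) (u : ℕ → Vh) :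
    ℕ → L2Field Ω
  | 0 => f
  | i + 1 => val (u i).1

/-- `(u i, p i)`, `i < ℓ`, is the `(i+1)`-st pair of discrete velocity and pressure snapshots. -/
def IsSnapshotSequence {Ω : Set (Pt d)} (ν : ℝ) (f : L2Field Ω)
    {Vh : Submodule ℝ (VelocitySpace Ω)} {Qh : Submodule ℝ (PressureSpace Ω)}
    (ℓ : ℕ) (u : ℕ → Vh) (p : ℕ → Qh) : Prop :=
  ∀ i < ℓ,
    (∀ v : Vh, formA ν (u i).1 v.1 + formB v.1 (p i).1 = inner ℝ (load f u i) (val v.1)) ∧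
    (∀ q : Qh, formB (u i).1 q.1 = 0)

/-- The stiffness matrix `A_{ij} = a(φ_j, φ_i)`. -/
def stiffness {Ω : Set (Pt d)} (ν : ℝ) {Vh : Submodule ℝ (VelocitySpace Ω)} {N : ℕ}
    (φ : Module.Basis (Fin N) ℝ Vh) : Matrix (Fin N) (Fin N) ℝ :=
  Matrix.of fun i j => formA ν (φ j).1 (φ i).1

/-- The matrix `U_r = [u_1 | ... | u_r]` of the coefficient vectors of the velocity snapshots. -/
def coeffMatrix {Ω : Set (Pt d)} {Vh : Submodule ℝ (VelocitySpace Ω)} {N : ℕ}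
    (φ : Module.Basis (Fin N) ℝ Vh) (u : ℕ → Vh) (r : ℕ) : Matrix (Fin N) (Fin r) ℝ :=
  Matrix.of fun j i => φ.repr (u i) j

/-- `K_r = U_rᵀ A U_r`. -/
def snapshotGram {Ω : Set (Pt d)} (ν : ℝ) {Vh : Submodule ℝ (VelocitySpace Ω)} {N : ℕ}
    (φ : Module.Basis (Fin N) ℝ Vh) (u : ℕ → Vh) (r : ℕ) : Matrix (Fin r) (Fin r) ℝ :=
  (coeffMatrix φ u r).transpose * stiffness ν φ * coeffMatrix φ u r

/-- The `(i+1)`-st largest eigenvalue, counted with multiplicity, of a real symmetric matrix. -/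
def sortedEigenvalue {r : ℕ} {K : Matrix (Fin r) (Fin r) ℝ} (hK : K.IsHermitian) (i : Fin r) : ℝ :=
  hK.eigenvalues₀ (Fin.cast (Fintype.card_fin r).symm i)

end StokesROM

end

/-! Each velocity is discretely divergence-free, so testing with it removes the pressure and leaves
ν(∇u_{i+1}, ∇u_j) = (u_i, u_j). On the span of the gradients let J send ∇u_i to u_i. Then S = ν⁻¹J*J
is symmetric and nonnegative and sends ∇u_i to ∇u_{i+1}, so diagonalising S gives K_ij = ∑ w_l
θ_l^(i+j) with w, θ ≥ 0 (`exists_spectral_measure`). Thus K is the moment matrix of a positive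
measure on the half line: it is Hankel, and its form at the coefficient vector of a polynomial P is
∑ w_l P(θ_l)².

Decay of the eigenvalues (`sortedEigenvalue_hankel_le`): Courant–Fischer is applied to the
coefficient vectors of the multiples pR of a fixed p of degree at most 2k. Passing from pR to qR
costs (p/q)² on the nodes; the form at qR is at most λ₁ times the squared coefficient norm of qR;
returning to the norm of pR costs (q/p)² on the roots of zⁿ = -1, by discrete Parseval. What is
needed is a rational function p/q that is small on [0, ∞) and large at those roots, a Zolotarev
problem. A substitution moves the two sets into [ρ, 1] and [-1, -ρ], where ∏ (y - α_i)/(y + α_i)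
with geometrically spaced α_i serves. Its size is a product of tanh values, estimated by comparing a
midpoint sum with ∫ log coth(s/2) ds = π²/4.

Smallest eigenvalue (`sortedEigenvalue_last_le_exp`): a monic polynomial that vanishes at the nodes
above exp(-7/4) and is otherwise a power of X is a test vector of norm at least 1 with exponentially
small form. The number of such nodes is bounded independently of V_h because H¹₀ → L² is compact
(`card_large_nodes_le`), which is obtained from Poincaré–Wirtinger on small cubes. The mass of the
measure is K_00 ≤ ‖f‖²_{V'}/ν. -/

namespace StokesROM

/-! ### Variational bounds for ordered eigenvalues -/

section MinMax

open Matrix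

variable {n : ℕ} {K : Matrix (Fin n) (Fin n) ℝ}

/-- Coordinates in which the quadratic form of a symmetric matrix is diagonal. -/
theorem exists_diagonalizing_coordinates (hK : K.IsHermitian) :
    ∃ T : (Fin n → ℝ) ≃ₗ[ℝ] (Fin n → ℝ),
      (∀ x, x ⬝ᵥ K *ᵥ x = ∑ j, sortedEigenvalue hK j * T x j ^ 2) ∧
      ∀ x, x ⬝ᵥ x = ∑ j, T x j ^ 2 := by
  set e : Fin n ≃ Fin n :=
    (finCongr (Fintype.card_fin n).symm).trans (Fintype.equivOfCardEq (Fintype.card_fin _))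
  set b : OrthonormalBasis (Fin n) ℝ (EuclideanSpace ℝ (Fin n)) :=
    hK.eigenvectorBasis.reindex e.symm with hb
  have hKb : ∀ j, K *ᵥ (b j).ofLp = sortedEigenvalue hK j • (b j).ofLp := by
    intro j
    have h := hK.mulVec_eigenvectorBasis (e j)
    have h2 : hK.eigenvalues (e j) = sortedEigenvalue hK j := by
      simp [Matrix.IsHermitian.eigenvalues, sortedEigenvalue, e]
    rw [h2] at h
    simpa [hb] using h
  have hinner : ∀ x y : EuclideanSpace ℝ (Fin n), inner ℝ x y = x.ofLp ⬝ᵥ y.ofLp := by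
    intro x y
    rw [EuclideanSpace.inner_eq_star_dotProduct, dotProduct_comm]
    simp
  refine ⟨(WithLp.linearEquiv 2 ℝ (Fin n → ℝ)).symm.trans
    (b.repr.toLinearEquiv.trans (WithLp.linearEquiv 2 ℝ (Fin n → ℝ))), ?_, ?_⟩
  · intro x
    set z : EuclideanSpace ℝ (Fin n) := WithLp.toLp 2 x with hz
    have h1 : x ⬝ᵥ K *ᵥ x = inner ℝ z (WithLp.toLp 2 (K *ᵥ x)) := by rw [hinner]
    rw [h1, ← b.sum_inner_mul_inner]
    refine Finset.sum_congr rfl fun j _ => ?_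
    have h2 : inner ℝ (b j) (WithLp.toLp 2 (K *ᵥ x)) =
        sortedEigenvalue hK j * inner ℝ (b j) z := by
      rw [hinner, hinner, dotProduct_mulVec, ← mulVec_transpose]
      have : Kᵀ = K := by simpa [conjTranspose_eq_transpose_of_trivial] using hK.eq
      rw [this, hKb, smul_dotProduct, smul_eq_mul]
    rw [h2]
    have h3 : b.repr z j = inner ℝ (b j) z := b.repr_apply_apply z j
    change _ = _ * (b.repr z j) ^ 2
    rw [h3, real_inner_comm (b j) z]
    ring
  · intro x
    set z : EuclideanSpace ℝ (Fin n) := WithLp.toLp 2 x with hz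
    have h1 : x ⬝ᵥ x = inner ℝ z z := by rw [hinner]
    rw [h1, ← b.sum_inner_mul_inner]
    refine Finset.sum_congr rfl fun j _ => ?_
    have h3 : b.repr z j = inner ℝ (b j) z := b.repr_apply_apply z j
    change _ = (b.repr z j) ^ 2
    rw [h3, real_inner_comm (b j) z]
    ring

theorem sortedEigenvalue_antitone (hK : K.IsHermitian) : Antitone (sortedEigenvalue hK) := by
  intro i j hij
  exact hK.eigenvalues₀_antitone (show (i : ℕ) ≤ j from hij)

/-- Courant–Fischer: an upper bound for the Rayleigh quotient on a subspace of codimension at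
most `i` bounds the `i`-th eigenvalue. -/
theorem sortedEigenvalue_le_of_subspace (hK : K.IsHermitian) (i : Fin n) (c : ℝ)
    (S : Submodule ℝ (Fin n → ℝ)) (hS : n ≤ Module.finrank ℝ S + i)
    (h : ∀ x ∈ S, x ⬝ᵥ K *ᵥ x ≤ c * (x ⬝ᵥ x)) : sortedEigenvalue hK i ≤ c := by
  obtain ⟨T, hT, hT1⟩ := exists_diagonalizing_coordinates hK
  -- Only n - 1 - i diagonal coordinates have index above i, fewer than dim S. Hence some nonzero x
  -- in S involves only eigenvalues of index at most i.
  let f : S →ₗ[ℝ] ({j : Fin n // i < j} → ℝ) :=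
    (LinearMap.funLeft ℝ ℝ (Subtype.val : {j : Fin n // i < j} → Fin n)) ∘ₗ
      T.toLinearMap ∘ₗ S.subtype
  have hcard : Fintype.card {j : Fin n // i < j} = n - 1 - i := by
    rw [Fintype.card_subtype]
    have : Finset.univ.filter (fun j : Fin n => i < j) = Finset.Ioi i := by ext; simp
    rw [this, Fin.card_Ioi]
  have hker : LinearMap.ker f ≠ ⊥ := by
    apply LinearMap.ker_ne_bot_of_finrank_lt
    rw [Module.finrank_fintype_fun_eq_card, hcard]
    have := i.2
    omega
  obtain ⟨x, hx, hx0⟩ := Submodule.exists_mem_ne_zero_of_ne_bot hker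
  have hTx : ∀ j, i < j → T x.1 j = 0 := by
    intro j hj
    exact congrFun (LinearMap.mem_ker.1 hx) ⟨j, hj⟩
  have hx0' : x.1 ≠ 0 := by simpa using hx0
  have hpos : 0 < x.1 ⬝ᵥ x.1 := by
    have := dotProduct_star_self_pos_iff.2 hx0'
    simpa using this
  have hle : sortedEigenvalue hK i * (x.1 ⬝ᵥ x.1) ≤ x.1 ⬝ᵥ K *ᵥ x.1 := by
    rw [hT, hT1, Finset.mul_sum]
    refine Finset.sum_le_sum fun j _ => ?_
    rcases lt_or_ge i j with hj | hj
    · simp [hTx j hj]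
    · exact mul_le_mul_of_nonneg_right (sortedEigenvalue_antitone hK hj) (sq_nonneg _)
  have := hle.trans (h x.1 x.2)
  exact le_of_mul_le_mul_right this hpos

theorem dotProduct_mulVec_le_sortedEigenvalue_zero (hK : K.IsHermitian) (hn : 0 < n)
    (x : Fin n → ℝ) : x ⬝ᵥ K *ᵥ x ≤ sortedEigenvalue hK ⟨0, hn⟩ * (x ⬝ᵥ x) := by
  obtain ⟨T, hT, hT1⟩ := exists_diagonalizing_coordinates hK
  rw [hT, hT1, Finset.mul_sum]
  refine Finset.sum_le_sum fun j _ => ?_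
  exact mul_le_mul_of_nonneg_right
    (sortedEigenvalue_antitone hK (by simp [Fin.le_def])) (sq_nonneg _)

theorem sortedEigenvalue_pos (hK : K.IsHermitian) (hpos : ∀ x ≠ 0, 0 < x ⬝ᵥ K *ᵥ x)
    (i : Fin n) : 0 < sortedEigenvalue hK i := by
  obtain ⟨T, hT, -⟩ := exists_diagonalizing_coordinates hK
  have h := hpos (T.symm (Pi.single i 1)) (by simp)
  rw [hT] at h
  simpa [Pi.single_apply, ite_pow] using h

end MinMax

/-! ### Moment matrices as quadratic forms on polynomials -/

section Moments

open Matrix Polynomial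

variable {n : ℕ} {K : Matrix (Fin n) (Fin n) ℝ} {ι : Type*} [Fintype ι] {w θ : ι → ℝ}

/-- The moment representation turns the form into the integral of P² against the measure, so
eigenvalue bounds become polynomial extremal problems. -/
theorem dotProduct_mulVec_coeff (hKw : ∀ i j : Fin n, K i j = ∑ l, w l * θ l ^ ((i : ℕ) + j))
    (P : ℝ[X]) (hP : P.degree < n) :
    (fun i : Fin n => P.coeff i) ⬝ᵥ K *ᵥ (fun i : Fin n => P.coeff i) =
      ∑ l, w l * P.eval (θ l) ^ 2 := by
  have hev : ∀ t : ℝ, P.eval t = ∑ i : Fin n, P.coeff i * t ^ (i : ℕ) := by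
    intro t
    rcases eq_or_ne P 0 with rfl | h0
    · simp
    · rw [eval_eq_sum_range' ((natDegree_lt_iff_degree_lt h0).2 hP), Finset.sum_range]
  simp only [dotProduct, mulVec, hKw, hev, sq, Finset.mul_sum, Finset.sum_mul]
  calc _ = ∑ i : Fin n, ∑ l, ∑ j : Fin n, P.coeff i * (w l * θ l ^ ((i : ℕ) + j) * P.coeff j) :=
        Finset.sum_congr rfl fun i _ => Finset.sum_comm
    _ = _ := by
      rw [Finset.sum_comm]
      refine Finset.sum_congr rfl fun l _ => Finset.sum_congr rfl fun i _ =>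
        Finset.sum_congr rfl fun j _ => ?_
      rw [pow_add]
      ring

theorem degree_mul_lt_of_natDegree_le {m : ℕ} (hm : m ≤ n) {s R : ℝ[X]} (hs : s.natDegree ≤ m)
    (hR : R.degree < (n - m : ℕ)) : (s * R).degree < n := by
  rcases eq_or_ne R 0 with rfl | hR0
  · simp
  rcases eq_or_ne s 0 with rfl | hs0
  · simp
  rw [← natDegree_lt_iff_degree_lt (mul_ne_zero hs0 hR0), natDegree_mul hs0 hR0]
  have := (natDegree_lt_iff_degree_lt hR0).2 hR
  omega

/-- Comparison of a Hankel matrix on multiples of `p` with the multiples of `q`. -/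
theorem sortedEigenvalue_le_of_polynomials (hK : K.IsHermitian) (hn : 0 < n)
    (hKw : ∀ i j : Fin n, K i j = ∑ l, w l * θ l ^ ((i : ℕ) + j)) (hw : ∀ l, 0 ≤ w l)
    (p q : ℝ[X]) (m : ℕ) (hm : m < n) (hp0 : p ≠ 0) (hpm : p.natDegree ≤ m) (hqm : q.natDegree ≤ m)
    (A B : ℝ) (hA : 0 ≤ A)
    (hA' : ∀ l, (p.eval (θ l)) ^ 2 ≤ A * (q.eval (θ l)) ^ 2)
    (hBq : ∀ R : ℝ[X], R.degree < (n - m : ℕ) →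
      ∑ i : Fin n, ((q * R).coeff i) ^ 2 ≤ B * ∑ i : Fin n, ((p * R).coeff i) ^ 2)
    (h0 : 0 ≤ sortedEigenvalue hK ⟨0, hn⟩) :
    sortedEigenvalue hK ⟨m, hm⟩ ≤ A * B * sortedEigenvalue hK ⟨0, hn⟩ := by
  let f : degreeLT ℝ (n - m) →ₗ[ℝ] (Fin n → ℝ) :=
    (LinearMap.pi fun i : Fin n => lcoeff ℝ i) ∘ₗ (LinearMap.mulLeft ℝ p) ∘ₗ
      (degreeLT ℝ (n - m)).subtype
  have hf : ∀ R : degreeLT ℝ (n - m), f R = fun i : Fin n => (p * R.1).coeff i := fun R => rfl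
  have hinj : Function.Injective f := by
    rw [injective_iff_map_eq_zero]
    intro R hR
    have : p * R.1 = 0 := by
      ext i
      rw [coeff_zero]
      rcases lt_or_ge i n with hi | hi
      · exact congrFun hR ⟨i, hi⟩
      · exact coeff_eq_zero_of_degree_lt
          ((degree_mul_lt_of_natDegree_le hm.le hpm (mem_degreeLT.1 R.2)).trans_le
            (by exact_mod_cast hi))
    rcases mul_eq_zero.1 this with h | h
    · exact absurd h hp0
    · exact Subtype.ext h
  have hfr : Module.finrank ℝ (LinearMap.range f) = n - m := by
    rw [LinearMap.finrank_range_of_inj hinj, (degreeLTEquiv ℝ (n - m)).finrank_eq]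
    simp
  refine sortedEigenvalue_le_of_subspace hK ⟨m, hm⟩ _ (LinearMap.range f)
    (by rw [hfr]; simp only; omega) ?_
  rintro _ ⟨R, rfl⟩
  have hR := mem_degreeLT.1 R.2
  rw [hf, dotProduct_mulVec_coeff hKw _ (degree_mul_lt_of_natDegree_le hm.le hpm hR)]
  -- Exchange p for q under the measure; the form at qR is then bounded by λ₁, and `hBq` exchanges q
  -- back for p in the coefficient norm.
  have h1 : ∑ l, w l * ((p * R.1).eval (θ l)) ^ 2 ≤ A * ∑ l, w l * ((q * R.1).eval (θ l)) ^ 2 := by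
    rw [Finset.mul_sum]
    refine Finset.sum_le_sum fun l _ => ?_
    rw [eval_mul, eval_mul, mul_pow, mul_pow]
    have := mul_le_mul_of_nonneg_left (hA' l) (mul_nonneg (hw l) (sq_nonneg (R.1.eval (θ l))))
    linarith
  rw [← dotProduct_mulVec_coeff hKw _ (degree_mul_lt_of_natDegree_le hm.le hqm hR)] at h1
  have h2 := dotProduct_mulVec_le_sortedEigenvalue_zero hK hn (fun i : Fin n => (q * R.1).coeff i)
  have h3 := hBq R.1 hR
  have e1 : ∀ s : ℝ[X], (fun i : Fin n => s.coeff i) ⬝ᵥ (fun i : Fin n => s.coeff i) =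
      ∑ i : Fin n, (s.coeff i) ^ 2 := fun s => by simp [dotProduct, sq]
  rw [e1] at h2 ⊢
  calc _ ≤ A * (sortedEigenvalue hK ⟨0, hn⟩ *
        (B * ∑ i : Fin n, ((p * R.1).coeff i) ^ 2)) :=
        h1.trans (mul_le_mul_of_nonneg_left
          (h2.trans (mul_le_mul_of_nonneg_left h3 h0)) hA)
    _ = _ := by ring

/-- A polynomial of degree `n - 1` with large coefficients that is small on the measure gives a
small eigenvalue. -/
theorem sortedEigenvalue_last_le (hK : K.IsHermitian) (hn : 0 < n)
    (hKw : ∀ i j : Fin n, K i j = ∑ l, w l * θ l ^ ((i : ℕ) + j)) (hw : ∀ l, 0 ≤ w l)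
    (P : ℝ[X]) (hP : P.Monic) (hPn : P.natDegree < n) (B : ℝ) (hB : 0 ≤ B)
    (hPB : ∀ l, P.eval (θ l) ^ 2 ≤ B) :
    sortedEigenvalue hK ⟨n - 1, by omega⟩ ≤ B * ∑ l, w l := by
  set x : Fin n → ℝ := fun i => P.coeff i with hx
  have hxi : x ⟨P.natDegree, hPn⟩ = 1 := hP
  -- The leading coefficient alone contributes 1.
  have hxx : 1 ≤ x ⬝ᵥ x := by
    have := Finset.single_le_sum (f := fun i => x i * x i) (fun i _ => mul_self_nonneg (x i))
      (Finset.mem_univ ⟨P.natDegree, hPn⟩)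
    simpa [hxi, dotProduct] using this
  have hx0 : x ≠ 0 := by
    intro h
    rw [h] at hxi
    simp at hxi
  have hS : 0 ≤ ∑ l, w l := Finset.sum_nonneg fun l _ => hw l
  refine sortedEigenvalue_le_of_subspace hK _ _ (Submodule.span ℝ {x}) ?_ ?_
  · rw [finrank_span_singleton hx0]
    simp only
    omega
  · intro y hy
    obtain ⟨c, rfl⟩ := Submodule.mem_span_singleton.1 hy
    have h1 : x ⬝ᵥ K *ᵥ x ≤ B * ∑ l, w l := by
      rw [hx, dotProduct_mulVec_coeff hKw P ((natDegree_lt_iff_degree_lt hP.ne_zero).1 hPn),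
        Finset.mul_sum]
      refine Finset.sum_le_sum fun l _ => ?_
      rw [mul_comm B]
      exact mul_le_mul_of_nonneg_left (hPB l) (hw l)
    have h2 : x ⬝ᵥ K *ᵥ x ≤ (B * ∑ l, w l) * (x ⬝ᵥ x) :=
      h1.trans (le_mul_of_one_le_right (mul_nonneg hB hS) hxx)
    rw [mulVec_smul, smul_dotProduct, dotProduct_smul, smul_dotProduct, dotProduct_smul]
    simp only [smul_eq_mul]
    nlinarith [mul_self_nonneg c]

end Moments

/-! ### Discrete Parseval on the roots of zⁿ = -1 -/

section RootsOfUnity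

open Polynomial

theorem cos_le_cos_of_le_of_le {x y : ℝ} (hy : 0 ≤ y) (h1 : y ≤ x)
    (h2 : x ≤ 2 * Real.pi - y) : Real.cos x ≤ Real.cos y := by
  rcases le_total x Real.pi with h | h
  · exact Real.cos_le_cos_of_nonneg_of_le_pi hy h h1
  · rw [← Real.cos_two_pi_sub x]
    exact Real.cos_le_cos_of_nonneg_of_le_pi hy (by linarith) (by linarith)

/-- The discrete Parseval identity on the roots of `z ^ n = -1`. -/
theorem exists_parseval_nodes (n : ℕ) (hn : 0 < n) :
    ∃ ζ : Fin n → ℂ, (∀ j, ‖ζ j‖ = 1 ∧ (ζ j).re ≤ Real.cos (Real.pi / n)) ∧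
      ∀ s : ℝ[X], s.degree < n →
        (n : ℝ) * ∑ i : Fin n, s.coeff i ^ 2 = ∑ j, ‖aeval (ζ j) s‖ ^ 2 := by
  have hnR : (0 : ℝ) < n := by exact_mod_cast hn
  -- Roots of -1 rather than of 1: the half-step shift keeps every node at angular distance at least
  -- π/n from 1, where the unit circle meets the half line.
  set ang : ℕ → ℝ := fun j => (2 * j + 1) * (Real.pi / n) with hang
  set ζ : ℕ → ℂ := fun j => Complex.exp (ang j * Complex.I) with hζ
  have hnorm : ∀ j, ‖ζ j‖ = 1 := fun j => Complex.norm_exp_ofReal_mul_I _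
  have hne : ∀ j, ζ j ≠ 0 := fun j => Complex.exp_ne_zero _
  set om : ℂ := Complex.exp (2 * Real.pi * Complex.I / n) with hom
  have hprim : IsPrimitiveRoot om n := Complex.isPrimitiveRoot_exp n hn.ne'
  have hζom : ∀ j, ζ j = ζ 0 * om ^ j := by
    intro j
    rw [hζ, hom, ← Complex.exp_nat_mul, ← Complex.exp_add]
    simp only [hang]
    push_cast
    congr 1
    ring
  have horth : ∀ a b : Fin n, ∑ j : Fin n, ζ j ^ (a : ℕ) * (starRingEnd ℂ) (ζ j ^ (b : ℕ)) =
      if a = b then (n : ℂ) else 0 := by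
    intro a b
    have hterm : ∀ j : ℕ, ζ j ^ (a : ℕ) * (starRingEnd ℂ) (ζ j ^ (b : ℕ)) =
        ζ 0 ^ ((a : ℤ) - b) * (om ^ ((a : ℤ) - b)) ^ j := by
      intro j
      have h1 : (starRingEnd ℂ) (ζ j) = (ζ j)⁻¹ := (Complex.inv_eq_conj (hnorm j)).symm
      rw [map_pow, h1, inv_pow]
      rw [← zpow_natCast (ζ j) a, ← zpow_natCast (ζ j) b, ← div_eq_mul_inv, ← zpow_sub₀ (hne j),
        hζom j, mul_zpow, ← zpow_natCast, ← zpow_natCast, ← zpow_mul, ← zpow_mul,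
        mul_comm (j : ℤ)]
    split_ifs with hab
    · subst hab
      simp_rw [hterm]
      simp
    · simp_rw [hterm]
      rw [← Finset.mul_sum]
      set η := om ^ ((a : ℤ) - b) with hη
      have hη1 : η ≠ 1 := by
        intro h
        have hd := (hprim.zpow_eq_one_iff_dvd _).1 h
        have ha := a.2
        have hb := b.2
        have : (a : ℤ) - b = 0 := Int.eq_zero_of_abs_lt_dvd hd (by rw [abs_lt]; omega)
        exact hab (Fin.ext (by omega))
      have hηn : η ^ n = 1 := by
        rw [hη, ← zpow_natCast, ← zpow_mul, mul_comm, zpow_mul, zpow_natCast, hprim.pow_eq_one,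
          one_zpow]
      have hs : ∑ j : Fin n, η ^ (j : ℕ) = 0 := by
        rw [Fin.sum_univ_eq_sum_range (fun j => η ^ j), geom_sum_eq hη1, hηn]
        simp
      rw [hs, mul_zero]
  refine ⟨fun j => ζ j, fun j => ⟨hnorm j, ?_⟩, ?_⟩
  · have hre : (ζ j).re = Real.cos (ang j) := Complex.exp_ofReal_mul_I_re _
    rw [hre]
    have hp : 0 ≤ Real.pi / n := by positivity
    have hj : ((j : ℕ) : ℝ) + 1 ≤ n := by exact_mod_cast j.2
    refine cos_le_cos_of_le_of_le hp ?_ ?_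
    · simp only [hang]
      nlinarith [(Nat.cast_nonneg (j : ℕ) : (0 : ℝ) ≤ (j : ℕ))]
    · have h2 : 2 * Real.pi = (2 * n) * (Real.pi / n) := by field_simp
      rw [h2]
      simp only [hang]
      nlinarith
  · intro s hs
    have hev : ∀ z : ℂ, aeval z s = ∑ i : Fin n, (s.coeff i : ℂ) * z ^ (i : ℕ) := by
      intro z
      rcases eq_or_ne s 0 with rfl | h0
      · simp
      · rw [aeval_eq_sum_range' ((natDegree_lt_iff_degree_lt h0).2 hs), Finset.sum_range]
        simp
    have hC : ((∑ j : Fin n, ‖aeval (ζ j) s‖ ^ 2 : ℝ) : ℂ) =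
        ((n : ℝ) * ∑ i : Fin n, s.coeff i ^ 2 : ℝ) := by
      push_cast
      have h1 : ∀ j : Fin n, ((‖aeval (ζ j) s‖ : ℂ)) ^ 2 =
          ∑ a : Fin n, ∑ b : Fin n, ((s.coeff a : ℂ) * s.coeff b) *
            (ζ j ^ (a : ℕ) * (starRingEnd ℂ) (ζ j ^ (b : ℕ))) := by
        intro j
        rw [← Complex.mul_conj', hev, map_sum, Finset.sum_mul_sum]
        refine Finset.sum_congr rfl fun a _ => Finset.sum_congr rfl fun b _ => ?_
        rw [map_mul, Complex.conj_ofReal]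
        ring
      rw [Finset.sum_congr rfl fun j _ => h1 j, Finset.sum_comm, Finset.mul_sum]
      refine Finset.sum_congr rfl fun a _ => ?_
      rw [Finset.sum_comm]
      simp_rw [← Finset.mul_sum, horth]
      simp
      ring
    exact_mod_cast hC.symm

/-- Both products have degree below n, so Parseval makes the comparison pointwise at the nodes,
where R is a common factor. -/
theorem sum_coeff_sq_le_of_norm_aeval_le (n : ℕ) (hn : 0 < n) (p q : ℝ[X]) (M : ℝ)
    (h : ∀ z : ℂ, ‖z‖ = 1 → z.re ≤ Real.cos (Real.pi / n) → ‖aeval z q‖ ≤ M * ‖aeval z p‖)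
    (R : ℝ[X]) (hp : (p * R).degree < n) (hq : (q * R).degree < n) :
    ∑ i : Fin n, ((q * R).coeff i) ^ 2 ≤ M ^ 2 * ∑ i : Fin n, ((p * R).coeff i) ^ 2 := by
  obtain ⟨ζ, hζ, hpars⟩ := exists_parseval_nodes n hn
  have hnR : (0 : ℝ) < n := by exact_mod_cast hn
  refine le_of_mul_le_mul_left ?_ hnR
  rw [mul_left_comm, hpars _ hq, hpars _ hp, Finset.mul_sum]
  refine Finset.sum_le_sum fun j _ => ?_
  rw [map_mul, map_mul, norm_mul, norm_mul, ← mul_pow, ← mul_assoc]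
  exact pow_le_pow_left₀ (by positivity)
    (mul_le_mul_of_nonneg_right (h _ (hζ j).1 (hζ j).2) (norm_nonneg _)) 2

end RootsOfUnity

/-! ### The rational function separating the half line from the circle nodes -/

section RationalFunction

open Polynomial

/-- The numerator `(1 - α) c (X + 1)² - 4 (1 + α) X` of one factor of the rational function;
the denominator is obtained from `-α`. -/
noncomputable def shiftFactor (c α : ℝ) : ℝ[X] :=
  C ((1 - α) * c) * (X + 1) ^ 2 - C (4 * (1 + α)) * X

theorem natDegree_shiftFactor_le (c α : ℝ) : (shiftFactor c α).natDegree ≤ 2 := by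
  unfold shiftFactor
  compute_degree

theorem aeval_shiftFactor (c α : ℝ) (z : ℂ) : aeval z (shiftFactor c α) =
    (1 - α) * c * (z + 1) ^ 2 - 4 * (1 + α) * z := by
  simp [shiftFactor]

theorem eval_shiftFactor (c α x : ℝ) : (shiftFactor c α).eval x =
    (1 - α) * c * (x + 1) ^ 2 - 4 * (1 + α) * x := by
  simp [shiftFactor]

/-- With A = c(x + 1)² and y = (A - 4x)/(A + 4x), the factor of parameter α is (A + 4x)(y - α). The
inequality 4x ≤ (x + 1)² is exactly y ≥ ρ, and x ≥ 0 gives y ≤ 1. -/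
theorem prod_eval_shiftFactor_le {k : ℕ} (α : Fin k → ℝ) (c ρ M : ℝ) (hc : 1 < c)
    (hρ : ρ = (c - 1) / (c + 1)) (hα : ∀ i, 0 < α i)
    (hM : ∀ y, ρ ≤ y → y ≤ 1 → ∏ i, (|y - α i| / (y + α i)) ≤ M) {x : ℝ} (hx : 0 ≤ x) :
    |(∏ i, shiftFactor c (α i)).eval x| ≤ M * |(∏ i, shiftFactor c (-α i)).eval x| := by
  set A := c * (x + 1) ^ 2 with hA
  have hAB : 0 < A + 4 * x := by positivity
  have hx1 : 4 * x ≤ (x + 1) ^ 2 := by nlinarith [sq_nonneg (x - 1)]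
  set y := (A - 4 * x) / (A + 4 * x) with hy
  have hρ0 : 0 < ρ := by rw [hρ]; apply div_pos <;> linarith
  have hy1 : y ≤ 1 := by rw [hy, div_le_one hAB]; linarith
  have hyρ : ρ ≤ y := by
    rw [hy, hρ, div_le_div_iff₀ (by linarith) hAB]
    nlinarith
  have hypos : 0 < y := hρ0.trans_le hyρ
  have e1 : ∀ a : ℝ, (shiftFactor c a).eval x = (A + 4 * x) * (y - a) := by
    intro a
    have h : (A + 4 * x) * y = A - 4 * x := mul_div_cancel₀ _ hAB.ne'
    rw [eval_shiftFactor, mul_sub, h, hA]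
    ring
  rw [eval_prod, eval_prod, Finset.abs_prod, Finset.abs_prod]
  have h2 : ∀ i, |(shiftFactor c (α i)).eval x| =
      (|y - α i| / (y + α i)) * |(shiftFactor c (-α i)).eval x| := by
    intro i
    have := hα i
    rw [e1, e1, abs_mul, abs_mul, sub_neg_eq_add, abs_of_pos (add_pos hypos (hα i))]
    field_simp
  rw [Finset.prod_congr rfl fun i _ => h2 i, Finset.prod_mul_distrib]
  exact mul_le_mul_of_nonneg_right (hM y hyρ hy1)
    (Finset.prod_nonneg fun i _ => abs_nonneg _)

/-- On the unit circle (z + 1)² = (2 + 2 Re z) z, so with the real number A = c(2 + 2 Re z) and y =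
(4 - A)/(4 + A) the factor of parameter α has modulus (A + 4)|y + α|. The argument is now -y, so the
roles of α and -α are exchanged. The condition on c and t gives Ac ≤ 4, which is y ≥ ρ. -/
theorem prod_aeval_shiftFactor_le {k : ℕ} (α : Fin k → ℝ) (c ρ M t : ℝ) (hc : 1 < c)
    (hρ : ρ = (c - 1) / (c + 1)) (hα : ∀ i, 0 < α i)
    (hM : ∀ y, ρ ≤ y → y ≤ 1 → ∏ i, (|y - α i| / (y + α i)) ≤ M)
    (ht : c ^ 2 * (1 + t) ≤ 2) {z : ℂ} (hz : ‖z‖ = 1) (hzt : z.re ≤ t) :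
    ‖aeval z (∏ i, shiftFactor c (-α i))‖ ≤ M * ‖aeval z (∏ i, shiftFactor c (α i))‖ := by
  have hz0 : z ≠ 0 := by rintro rfl; simp at hz
  have hre : -1 ≤ z.re := by
    have := (abs_le.1 (Complex.abs_re_le_norm z)).1
    rwa [hz] at this
  set A := c * (2 + 2 * z.re) with hA
  have hA0 : 0 ≤ A := mul_nonneg (by linarith) (by linarith)
  have hAc : A * c ≤ 4 := by rw [hA]; nlinarith [sq_nonneg c]
  have hAB : 0 < A + 4 := by positivity
  set y := (4 - A) / (A + 4) with hy
  have hρ0 : 0 < ρ := by rw [hρ]; apply div_pos <;> linarith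
  have hy1 : y ≤ 1 := by rw [hy, div_le_one hAB]; linarith
  have hyρ : ρ ≤ y := by
    rw [hy, hρ, div_le_div_iff₀ (by linarith) hAB]
    nlinarith
  have hypos : 0 < y := hρ0.trans_le hyρ
  have hAz : (c : ℂ) * (z + 1) ^ 2 = A * z := by
    have h1 : z + (starRingEnd ℂ) z = (2 * z.re : ℝ) := Complex.add_conj z
    have h2 : z * (starRingEnd ℂ) z = 1 := by rw [Complex.mul_conj', hz]; simp
    rw [hA]
    push_cast at h1 ⊢
    rw [← h1]
    linear_combination -(c : ℂ) * h2
  have e1 : ∀ a : ℝ, ‖aeval z (shiftFactor c a)‖ = (A + 4) * |y + a| := by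
    intro a
    have h : aeval z (shiftFactor c a) = (-((A + 4) * (y + a)) : ℝ) * z := by
      have h3 : (A + 4) * (y + a) = 4 - A + a * (A + 4) := by
        rw [hy]; field_simp
      rw [aeval_shiftFactor, h3]
      push_cast
      linear_combination (1 - (a : ℂ)) * hAz
    rw [h, norm_mul, hz, mul_one, Complex.norm_real, Real.norm_eq_abs, abs_neg, abs_mul,
      abs_of_pos hAB]
  rw [map_prod, map_prod, norm_prod, norm_prod]
  have h2 : ∀ i, ‖aeval z (shiftFactor c (-α i))‖ =
      (|y - α i| / (y + α i)) * ‖aeval z (shiftFactor c (α i))‖ := by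
    intro i
    have := hα i
    rw [e1, e1, ← sub_eq_add_neg, abs_of_pos (add_pos hypos (hα i))]
    field_simp
  rw [Finset.prod_congr rfl fun i _ => h2 i, Finset.prod_mul_distrib]
  exact mul_le_mul_of_nonneg_right (hM y hyρ hy1)
    (Finset.prod_nonneg fun i _ => norm_nonneg _)

theorem prod_shiftFactor_ne_zero {k : ℕ} (α : Fin k → ℝ) (c : ℝ)
    (hα : ∀ i, 0 < α i) : ∏ i, shiftFactor c (α i) ≠ 0 := by
  refine Finset.prod_ne_zero_iff.2 fun i _ h => ?_
  have h1 := eval_shiftFactor c (α i) (-1)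
  rw [h] at h1
  have := hα i
  norm_num at h1
  linarith

theorem natDegree_prod_shiftFactor_le {k : ℕ} (α : Fin k → ℝ) (c : ℝ) :
    (∏ i, shiftFactor c (α i)).natDegree ≤ 2 * k := by
  refine (natDegree_prod_le _ _).trans ?_
  refine (Finset.sum_le_sum fun i _ => natDegree_shiftFactor_le c (α i)).trans ?_
  simp [mul_comm]

open Matrix in
/-- Decay of the eigenvalues of a positive semidefinite Hankel matrix with a representing measure
on the half line, in terms of a product over shift parameters. -/
theorem sortedEigenvalue_le_of_shifts {n : ℕ} {K : Matrix (Fin n) (Fin n) ℝ} {ι : Type*}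
    [Fintype ι] {w θ : ι → ℝ} (hK : K.IsHermitian) (hn : 0 < n)
    (hKw : ∀ i j : Fin n, K i j = ∑ l, w l * θ l ^ ((i : ℕ) + j)) (hw : ∀ l, 0 ≤ w l)
    (hθ : ∀ l, 0 ≤ θ l) (h0 : 0 ≤ sortedEigenvalue hK ⟨0, hn⟩)
    {k : ℕ} (hk : 2 * k < n) (α : Fin k → ℝ) (c ρ M : ℝ) (hc : 1 < c)
    (hρ : ρ = (c - 1) / (c + 1)) (hα : ∀ i, 0 < α i)
    (hM : ∀ y, ρ ≤ y → y ≤ 1 → ∏ i, (|y - α i| / (y + α i)) ≤ M)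
    (ht : c ^ 2 * (1 + Real.cos (Real.pi / n)) ≤ 2) :
    sortedEigenvalue hK ⟨2 * k, hk⟩ ≤ M ^ 4 * sortedEigenvalue hK ⟨0, hn⟩ := by
  have hp := natDegree_prod_shiftFactor_le α c
  have hq := natDegree_prod_shiftFactor_le (fun i => -α i) c
  -- One factor M² comes from the half line, the other from the circle.
  have := sortedEigenvalue_le_of_polynomials hK hn hKw hw (∏ i, shiftFactor c (α i))
    (∏ i, shiftFactor c (-α i)) (2 * k) hk (prod_shiftFactor_ne_zero α c hα) hp hq
    (M ^ 2) (M ^ 2) (sq_nonneg M) ?_ ?_ h0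
  · calc _ ≤ _ := this
      _ = _ := by ring
  · intro l
    rw [← sq_abs, ← sq_abs (eval _ _), ← mul_pow]
    exact pow_le_pow_left₀ (abs_nonneg _)
      (prod_eval_shiftFactor_le α c ρ M hc hρ hα hM (hθ l)) 2
  · intro R hR
    exact sum_coeff_sq_le_of_norm_aeval_le n hn _ _ M
      (fun z hz hzt => prod_aeval_shiftFactor_le α c ρ M _ hc hρ hα hM ht hz hzt) R
      (degree_mul_lt_of_natDegree_le hk.le hp hR) (degree_mul_lt_of_natDegree_le hk.le hq hR)

end RationalFunction

/-! ### Size of the node product: midpoint sums of log coth -/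

section NodeProduct

/-- `g(s) = -log tanh (s / 2)`. -/
noncomputable def logCoth (s : ℝ) : ℝ := Real.log (1 + Real.exp (-s)) - Real.log (1 - Real.exp (-s))

/-- The antiderivative of `-logCoth` that vanishes at infinity. -/
noncomputable def logCothTail (s : ℝ) : ℝ :=
  ∑' k : ℕ, 2 / (2 * (k : ℝ) + 1) ^ 2 * Real.exp (-((2 * k + 1) * s))

theorem hasSum_of_eq {f g : ℕ → ℝ} {a : ℝ} (hg : HasSum g a) (h : ∀ k, f k = g k) :
    HasSum f a :=
  (funext h : f = g) ▸ hg

/-- The series of log((1 + x)/(1 - x)) at x = exp(-s). It reduces integration and convexity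
estimates to single exponentials. -/
theorem hasSum_logCoth {s : ℝ} (hs : 0 < s) :
    HasSum (fun k : ℕ => 2 / (2 * (k : ℝ) + 1) * Real.exp (-((2 * k + 1) * s))) (logCoth s) := by
  have h1 : |Real.exp (-s)| < 1 := by
    rw [abs_of_pos (Real.exp_pos _), Real.exp_lt_one_iff]
    linarith
  refine hasSum_of_eq (Real.hasSum_log_sub_log_of_abs_lt_one h1) fun k => ?_
  rw [← Real.exp_nat_mul]
  push_cast
  rw [mul_neg]
  ring

theorem logCoth_nonneg {s : ℝ} (hs : 0 < s) : 0 ≤ logCoth s :=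
  (hasSum_logCoth hs).nonneg fun k => by positivity

/-- The even terms make up a quarter of ζ(2) = π²/6. The value is the integral of `logCoth` over the
half line. -/
theorem hasSum_odd_inv_sq :
    HasSum (fun k : ℕ => 2 / (2 * (k : ℝ) + 1) ^ 2) (Real.pi ^ 2 / 4) := by
  have h := hasSum_zeta_two
  have he : HasSum (fun k : ℕ => (1 : ℝ) / ((2 * k : ℕ) : ℝ) ^ 2) (1 / 4 * (Real.pi ^ 2 / 6)) := by
    refine hasSum_of_eq (h.mul_left (1 / 4)) fun k => ?_
    push_cast
    rw [mul_pow]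
    ring
  have hinj : Function.Injective fun k : ℕ => 2 * k + 1 := fun a b h => by simpa using h
  have ho : HasSum (fun k : ℕ => (1 : ℝ) / ((2 * k + 1 : ℕ) : ℝ) ^ 2)
      (∑' k : ℕ, (1 : ℝ) / ((2 * k + 1 : ℕ) : ℝ) ^ 2) :=
    (h.summable.comp_injective hinj).hasSum
  have hsum := (HasSum.even_add_odd (f := fun n : ℕ => (1 : ℝ) / (n : ℝ) ^ 2) he ho).unique h
  have := ho.mul_left 2
  have hv : 2 * (∑' k : ℕ, (1 : ℝ) / ((2 * k + 1 : ℕ) : ℝ) ^ 2) = Real.pi ^ 2 / 4 := by linarith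
  rw [hv] at this
  refine hasSum_of_eq this fun k => ?_
  push_cast
  ring

theorem logCothTail_term_le {s : ℝ} (hs : 0 ≤ s) (k : ℕ) :
    2 / (2 * (k : ℝ) + 1) ^ 2 * Real.exp (-((2 * k + 1) * s)) ≤
      2 / (2 * (k : ℝ) + 1) ^ 2 * Real.exp (-s) := by
  refine mul_le_mul_of_nonneg_left (Real.exp_le_exp.2 ?_) (by positivity)
  nlinarith [(Nat.cast_nonneg k : (0 : ℝ) ≤ k), mul_nonneg (Nat.cast_nonneg k : (0 : ℝ) ≤ k) hs]

theorem hasSum_logCothTail {s : ℝ} (hs : 0 ≤ s) :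
    HasSum (fun k : ℕ => 2 / (2 * (k : ℝ) + 1) ^ 2 * Real.exp (-((2 * k + 1) * s)))
      (logCothTail s) :=
  (Summable.of_nonneg_of_le (fun k => by positivity) (logCothTail_term_le hs)
    (hasSum_odd_inv_sq.summable.mul_right _)).hasSum

theorem logCothTail_zero : logCothTail 0 = Real.pi ^ 2 / 4 := by
  rw [← hasSum_odd_inv_sq.tsum_eq, logCothTail]
  simp

theorem logCothTail_le {s : ℝ} (hs : 0 ≤ s) :
    logCothTail s ≤ Real.pi ^ 2 / 4 * Real.exp (-s) :=
  hasSum_le (logCothTail_term_le hs) (hasSum_logCothTail hs) (hasSum_odd_inv_sq.mul_right _)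

theorem continuousOn_logCothTail : ContinuousOn logCothTail (Set.Ici 0) := by
  refine continuousOn_tsum (u := fun k : ℕ => 2 / (2 * (k : ℝ) + 1) ^ 2) (fun k => by fun_prop)
    hasSum_odd_inv_sq.summable fun k s hs => ?_
  rw [Real.norm_of_nonneg (by positivity)]
  refine (logCothTail_term_le hs k).trans (mul_le_of_le_one_right (by positivity) ?_)
  rw [Real.exp_le_one_iff]
  have : 0 ≤ s := hs
  linarith

/-- Termwise differentiation on (s/2, ∞), where the differentiated series is dominated by its value
at s/2. -/
theorem hasDerivAt_logCothTail {s : ℝ} (hs : 0 < s) :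
    HasDerivAt logCothTail (-logCoth s) s := by
  have h1 : s ∈ Set.Ioi (s / 2) := by simp [hs]
  have h := hasDerivAt_tsum_of_isPreconnected (𝕜 := ℝ) (F := ℝ) (t := Set.Ioi (s / 2)) (y₀ := s)
    (y := s) (u := fun k : ℕ => 2 / (2 * (k : ℝ) + 1) * Real.exp (-((2 * k + 1) * (s / 2))))
    (g := fun (k : ℕ) s => 2 / (2 * (k : ℝ) + 1) ^ 2 * Real.exp (-((2 * k + 1) * s)))
    (g' := fun (k : ℕ) s => -(2 / (2 * (k : ℝ) + 1) * Real.exp (-((2 * k + 1) * s))))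
    (hasSum_logCoth (half_pos hs)).summable isOpen_Ioi isPreconnected_Ioi ?_ ?_ h1
    (hasSum_logCothTail hs.le).summable h1
  · rw [tsum_neg, (hasSum_logCoth hs).tsum_eq] at h
    exact h
  · intro k y _
    have h2 := ((((hasDerivAt_id y).const_mul (2 * (k : ℝ) + 1)).neg).exp).const_mul
      (2 / (2 * (k : ℝ) + 1) ^ 2)
    convert! h2 using 1
    simp only [id, Pi.neg_apply]
    field_simp
  · intro k y hy
    rw [norm_neg, Real.norm_of_nonneg (by positivity)]
    have : s / 2 < y := hy
    gcongr

theorem hasDerivAt_logCoth {s : ℝ} (hs : 0 < s) :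
    HasDerivAt logCoth (-(1 / Real.sinh s)) s := by
  have hE : Real.exp (-s) < 1 := by rw [Real.exp_lt_one_iff]; linarith
  have he : HasDerivAt (fun s : ℝ => Real.exp (-s)) (-Real.exp (-s)) s := by
    simpa using (hasDerivAt_neg s).exp
  have h1 := (he.const_add 1).log (by positivity)
  have h2 := (he.const_sub 1).log (by linarith)
  convert! h1.sub h2 using 1
  rw [Real.sinh_eq]
  have h3 : Real.exp s = (Real.exp (-s))⁻¹ := by rw [Real.exp_neg, inv_inv]
  rw [h3]
  have hp := Real.exp_pos (-s)
  set x := Real.exp (-s)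
  have : 1 - x ≠ 0 := by linarith
  have : 1 + x ≠ 0 := by linarith
  have h4 : x⁻¹ - x = (1 - x) * (1 + x) / x := by field_simp; ring
  rw [h4]
  field_simp
  ring

/-- Controls the integral next to the logarithmic singularity. The difference of the two sides has
derivative s / sinh s - 1 ≤ 0 and a nonpositive limit at 0. -/
theorem logCothTail_zero_sub_le {x : ℝ} (hx : 0 < x) :
    logCothTail 0 - logCothTail x ≤ x * logCoth x + x := by
  set ψ : ℝ → ℝ := fun s => logCothTail 0 - logCothTail s - s * logCoth s - s with hψ
  have hd : ∀ s, 0 < s → HasDerivAt ψ (s / Real.sinh s - 1) s := by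
    intro s hs
    have h := (((hasDerivAt_logCothTail hs).const_sub (logCothTail 0)).sub
      ((hasDerivAt_id s).mul (hasDerivAt_logCoth hs))).sub (hasDerivAt_id s)
    convert! h using 1
    simp only [id]
    ring
  have hanti : AntitoneOn ψ (Set.Ioi 0) := by
    refine antitoneOn_of_deriv_nonpos (convex_Ioi 0)
      (fun s hs => (hd s hs).continuousAt.continuousWithinAt)
      (fun s hs => ?_) (fun s hs => ?_)
    · rw [interior_Ioi] at hs
      exact (hd s hs).differentiableAt.differentiableWithinAt
    · rw [interior_Ioi] at hs
      have hs' : 0 < s := hs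
      rw [(hd s hs').deriv]
      have : s / Real.sinh s ≤ 1 :=
        (div_le_one (Real.sinh_pos_iff.2 hs')).2 (Real.self_le_sinh_iff.2 hs'.le)
      linarith
  have hle : ∀ ε, 0 < ε → ε < x → ψ x ≤ logCothTail 0 - logCothTail ε := by
    intro ε h0 h1
    refine (hanti h0 hx h1.le).trans ?_
    have := mul_nonneg h0.le (logCoth_nonneg h0)
    simp only [hψ]
    linarith
  have hlim : Filter.Tendsto (fun ε => logCothTail 0 - logCothTail ε)
      (nhdsWithin 0 (Set.Ioi 0)) (nhds (logCothTail 0 - logCothTail 0)) :=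
    ((continuousOn_logCothTail 0 Set.self_mem_Ici).mono_left
      (nhdsWithin_mono _ Set.Ioi_subset_Ici_self)).const_sub _
  have := ge_of_tendsto hlim (b := ψ x) (by
    filter_upwards [Ioo_mem_nhdsGT hx] with ε hε
    exact hle ε hε.1 hε.2)
  rw [sub_self] at this
  simp only [hψ] at this
  linarith

theorem one_sub_exp_neg_le {y : ℝ} (hy : 0 ≤ y) :
    1 - Real.exp (-y) ≤ y / 2 * (1 + Real.exp (-y)) := by
  set f : ℝ → ℝ := fun y => y / 2 * (1 + Real.exp (-y)) - (1 - Real.exp (-y)) with hf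
  have hd : ∀ s, HasDerivAt f ((1 - (1 + s) * Real.exp (-s)) / 2) s := by
    intro s
    have he : HasDerivAt (fun s : ℝ => Real.exp (-s)) (-Real.exp (-s)) s := by
      simpa using (hasDerivAt_neg s).exp
    have h := (((hasDerivAt_id s).div_const 2).mul (he.const_add 1)).sub (he.const_sub 1)
    convert! h using 1
    simp only [id]
    ring
  have hmono : MonotoneOn f (Set.Ici 0) := by
    refine monotoneOn_of_deriv_nonneg (convex_Ici 0)
      (fun s _ => (hd s).continuousAt.continuousWithinAt)
      (fun s _ => (hd s).differentiableAt.differentiableWithinAt) (fun s _ => ?_)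
    rw [(hd s).deriv]
    have h1 := mul_le_mul_of_nonneg_right (Real.add_one_le_exp s) (Real.exp_pos (-s)).le
    rw [← Real.exp_add, add_neg_cancel, Real.exp_zero] at h1
    linarith
  have := hmono Set.self_mem_Ici hy hy
  simp [hf] at this
  linarith

/-- The trapezoidal rule overestimates the integral of a convex function; here it is applied to each
exponential of the series. -/
theorem logCothTail_sub_le {x δ : ℝ} (hx : 0 < x) (hδ : 0 < δ) :
    logCothTail x - logCothTail (x + δ) ≤ δ / 2 * (logCoth x + logCoth (x + δ)) := by
  refine hasSum_le ?_ ((hasSum_logCothTail hx.le).sub (hasSum_logCothTail (by positivity)))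
    (((hasSum_logCoth hx).add (hasSum_logCoth (by positivity))).mul_left (δ / 2))
  intro k
  have hN : (0 : ℝ) < 2 * k + 1 := by positivity
  set N : ℝ := 2 * k + 1
  have h := one_sub_exp_neg_le (y := N * δ) (by positivity)
  have he : Real.exp (-(N * (x + δ))) = Real.exp (-(N * x)) * Real.exp (-(N * δ)) := by
    rw [← Real.exp_add]; ring_nf
  rw [he]
  have h2 := mul_le_mul_of_nonneg_left h
    (show 0 ≤ 2 / N ^ 2 * Real.exp (-(N * x)) by positivity)
  calc _ = 2 / N ^ 2 * Real.exp (-(N * x)) * (1 - Real.exp (-(N * δ))) := by ring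
    _ ≤ _ := h2
    _ = _ := by field_simp

/-- Trapezoids between consecutive nodes give both end nodes weight δ/2. The estimate on [0, δ/2]
supplies the missing half of the first one, at a cost of 1/2 after division by δ; the missing half
of the last is nonnegative. The exponential term bounds the integral beyond the last node. -/
theorem le_sum_logCoth {δ : ℝ} (hδ : 0 < δ) (k : ℕ) :
    Real.pi ^ 2 / (4 * δ) - 1 / 2 - Real.pi ^ 2 / (4 * δ) * Real.exp (-((k + 1 / 2) * δ)) ≤
      ∑ i ∈ Finset.range (k + 1), logCoth ((i + 1 / 2) * δ) := by
  have hind : ∀ k : ℕ, δ / 2 * logCoth (δ / 2) + δ / 2 * logCoth ((k + 1 / 2) * δ) +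
      (logCothTail (δ / 2) - logCothTail ((k + 1 / 2) * δ)) ≤
      δ * ∑ i ∈ Finset.range (k + 1), logCoth ((i + 1 / 2) * δ) := by
    intro k
    induction k with
    | zero =>
      have : ((0 : ℕ) + 1 / 2 : ℝ) * δ = δ / 2 := by push_cast; ring
      simp only [zero_add, Finset.sum_range_one, this]
      linarith
    | succ k ih =>
      rw [Finset.sum_range_succ, mul_add]
      have h := logCothTail_sub_le (x := (k + 1 / 2) * δ) (by positivity) hδ
      have e : ((k : ℝ) + 1 / 2) * δ + δ = ((k + 1 : ℕ) + 1 / 2) * δ := by push_cast; ring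
      rw [e] at h
      linarith
  have h1 := hind k
  have h2 := logCothTail_zero_sub_le (half_pos hδ)
  have hxk : 0 < (k + 1 / 2) * δ := by positivity
  have h3 := logCothTail_le hxk.le
  have h4 := mul_nonneg (half_pos hδ).le (logCoth_nonneg hxk)
  rw [logCothTail_zero] at h2
  refine le_of_mul_le_mul_left ?_ hδ
  refine le_trans ?_ h1
  have e : δ * (Real.pi ^ 2 / (4 * δ) - 1 / 2 -
      Real.pi ^ 2 / (4 * δ) * Real.exp (-((k + 1 / 2) * δ))) =
      Real.pi ^ 2 / 4 - δ / 2 - Real.pi ^ 2 / 4 * Real.exp (-((k + 1 / 2) * δ)) := by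
    field_simp
  rw [e]
  linarith

theorem exp_neg_logCoth {s : ℝ} (hs : 0 < s) :
    Real.exp (-logCoth s) = (1 - Real.exp (-s)) / (1 + Real.exp (-s)) := by
  have hE : Real.exp (-s) < 1 := by rw [Real.exp_lt_one_iff]; linarith
  rw [logCoth, neg_sub, Real.exp_sub, Real.exp_log (by linarith), Real.exp_log (by positivity)]

theorem prod_tanh_le {δ : ℝ} (hδ : 0 < δ) {k : ℕ} (hk : 0 < k) :
    ∏ i : Fin k, ((1 - Real.exp (-(((i : ℕ) + 1 / 2) * δ))) /
        (1 + Real.exp (-(((i : ℕ) + 1 / 2) * δ)))) ≤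
      Real.exp (1 / 2 + Real.pi ^ 2 / (4 * δ) * Real.exp (-((k - 1 / 2) * δ)) -
        Real.pi ^ 2 / (4 * δ)) := by
  obtain ⟨k, rfl⟩ := Nat.exists_eq_succ_of_ne_zero hk.ne'
  rw [Fin.prod_univ_eq_prod_range (fun i : ℕ => (1 - Real.exp (-(((i : ℕ) + 1 / 2) * δ))) /
        (1 + Real.exp (-(((i : ℕ) + 1 / 2) * δ)))),
    ← Finset.prod_congr rfl fun i _ => exp_neg_logCoth (s := ((i : ℕ) + 1 / 2) * δ)
      (by positivity), ← Real.exp_sum, Finset.sum_neg_distrib]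
  refine Real.exp_le_exp.2 ?_
  have h := le_sum_logCoth hδ k
  have e : ((k.succ : ℕ) : ℝ) - 1 / 2 = k + 1 / 2 := by push_cast; ring
  rw [e]
  linarith

theorem one_sub_exp_div_mono {D D' : ℝ} (h : D ≤ D') :
    (1 - Real.exp (-D)) / (1 + Real.exp (-D)) ≤ (1 - Real.exp (-D')) / (1 + Real.exp (-D')) := by
  have h1 : Real.exp (-D') ≤ Real.exp (-D) := Real.exp_le_exp.2 (by linarith)
  rw [div_le_div_iff₀ (by positivity) (by positivity)]
  nlinarith

/-- Each factor is tanh(|a - b|/2): only the distance on the logarithmic scale matters, and it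
enters monotonically. -/
theorem abs_exp_sub_exp_div (a b : ℝ) :
    |Real.exp (-a) - Real.exp (-b)| / (Real.exp (-a) + Real.exp (-b)) =
      (1 - Real.exp (-|a - b|)) / (1 + Real.exp (-|a - b|)) := by
  wlog h : a ≤ b generalizing a b
  · rw [abs_sub_comm, add_comm, this b a (le_of_not_ge h), abs_sub_comm b a]
  have h1 : Real.exp (-b) ≤ Real.exp (-a) := Real.exp_le_exp.2 (by linarith)
  have h2 : Real.exp (-|a - b|) = Real.exp (-b) / Real.exp (-a) := by
    rw [abs_of_nonpos (by linarith), ← Real.exp_sub]; ring_nf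
  rw [abs_of_nonneg (by linarith), h2]
  have := Real.exp_pos (-a)
  field_simp

/-- For equidistant nodes the product of the factors is largest at the end point. -/
theorem prod_abs_sub_div_le {δ : ℝ} (hδ : 0 < δ) {k : ℕ} {y : ℝ}
    (hy0 : Real.exp (-(k * δ)) ≤ y) (hy1 : y ≤ 1) (hk : 0 < k) :
    ∏ i : Fin k, (|y - Real.exp (-(((i : ℕ) + 1 / 2) * δ))| /
        (y + Real.exp (-(((i : ℕ) + 1 / 2) * δ)))) ≤
      ∏ i : Fin k, ((1 - Real.exp (-(((i : ℕ) + 1 / 2) * δ))) /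
        (1 + Real.exp (-(((i : ℕ) + 1 / 2) * δ)))) := by
  have hypos : 0 < y := (Real.exp_pos _).trans_le hy0
  obtain ⟨η, rfl⟩ : ∃ η, Real.exp (-η) = y := ⟨-Real.log y, by rw [neg_neg, Real.exp_log hypos]⟩
  have hη0 : 0 ≤ η := by
    rw [Real.exp_le_one_iff] at hy1; linarith
  have hηk : η ≤ k * δ := by
    have := Real.exp_le_exp.1 hy0; linarith
  obtain ⟨j₀, hj₀, hl, hu⟩ : ∃ j₀ : ℕ, j₀ < k ∧ j₀ * δ ≤ η ∧ η ≤ (j₀ + 1) * δ := by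
    rcases hηk.lt_or_eq with h | h
    · have h1 : η / δ < k := (div_lt_iff₀ hδ).2 h
      refine ⟨⌊η / δ⌋₊, (Nat.floor_lt (by positivity)).2 h1, ?_, ?_⟩
      · exact (le_div_iff₀ hδ).1 (Nat.floor_le (by positivity))
      · exact (div_le_iff₀ hδ).1 (Nat.lt_floor_add_one _).le
    -- At the far end point the floor would be k, which is not a cell index.
    · refine ⟨k - 1, by omega, ?_, ?_⟩
      · rw [h]
        exact mul_le_mul_of_nonneg_right (by exact_mod_cast Nat.sub_le k 1) hδ.le
      · rw [h, Nat.cast_sub hk]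
        push_cast
        linarith
  -- As η lies in cell j₀, the node j is within (j₀ - j + 1/2)δ of it when j ≤ j₀, and within (j +
  -- 1/2)δ otherwise. Reflecting the indices up to j₀ therefore gives a factorwise comparison with y
  -- = 1.
  let rank : Fin k → Fin k := fun j => if (j : ℕ) ≤ j₀ then ⟨j₀ - j, by omega⟩ else j
  have hinv : Function.Involutive rank := by
    intro j
    by_cases h : (j : ℕ) ≤ j₀
    · simp only [rank, h, if_true]
      ext
      simp
      omega
    · simp [rank, h]
  conv_rhs => rw [← Equiv.prod_comp hinv.toPerm]
  refine Finset.prod_le_prod (fun j _ => by positivity) fun j _ => ?_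
  rw [abs_exp_sub_exp_div]
  apply one_sub_exp_div_mono
  change _ ≤ (((rank j : Fin k) : ℕ) + 1 / 2 : ℝ) * δ
  by_cases h : (j : ℕ) ≤ j₀
  · have e : (((rank j : Fin k) : ℕ) : ℝ) = j₀ - (j : ℕ) := by
      simp only [rank, h, if_true]
      push_cast [h]
      ring
    rw [e, abs_le]
    have : ((j : ℕ) : ℝ) ≤ j₀ := by exact_mod_cast h
    constructor <;> nlinarith
  · have e : (((rank j : Fin k) : ℕ) : ℝ) = (j : ℕ) := by simp [rank, h]
    rw [e, abs_le]
    have : (j₀ : ℝ) + 1 ≤ (j : ℕ) := by exact_mod_cast not_le.1 h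
    have h0 : (0 : ℝ) ≤ j₀ := Nat.cast_nonneg _
    constructor <;> nlinarith

end NodeProduct

/-! ### Choice of parameters and the decay rate -/

section HankelDecay

open Matrix

theorem log_bounds {n : ℕ} (hn : 5 ≤ n) : 3 / 2 ≤ Real.log (4 * n / Real.pi) := by
  have hnR : (5 : ℝ) ≤ n := by exact_mod_cast hn
  have hpi := Real.pi_pos
  rw [Real.le_log_iff_exp_le (by positivity), le_div_iff₀ hpi]
  have h1 : Real.exp (3 / 2) ≤ 5 := by
    have h2 : Real.exp (3 / 2) ^ 2 = Real.exp 1 ^ 3 := by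
      rw [← Real.exp_nat_mul, ← Real.exp_nat_mul]; norm_num
    have h3 : Real.exp 1 ^ 3 ≤ 2.72 ^ 3 :=
      pow_le_pow_left₀ (Real.exp_pos 1).le (Real.exp_one_lt_d9.le.trans (by norm_num)) 3
    nlinarith [Real.exp_pos (3 / 2)]
  nlinarith [Real.pi_lt_d2]

theorem exp_neg_log_eq {n : ℕ} (hn : 5 ≤ n) :
    Real.exp (-Real.log (4 * n / Real.pi)) = Real.pi / (4 * n) := by
  have hnR : (5 : ℝ) ≤ n := by exact_mod_cast hn
  have hpi := Real.pi_pos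
  rw [Real.exp_neg, Real.exp_log (by positivity), inv_div]

/-- The truncation error and the discretisation error of the node product stay below `log 2`. -/
theorem prod_tanh_le_two_mul {n k : ℕ} (hk : 2 ≤ k) (hkn : 2 * k < n) {h δ : ℝ}
    (hh : h = Real.log (4 * n / Real.pi)) (hδ : δ = 2 * h / k) :
    ∏ i : Fin k, ((1 - Real.exp (-(((i : ℕ) + 1 / 2) * δ))) /
        (1 + Real.exp (-(((i : ℕ) + 1 / 2) * δ)))) ≤
      2 * Real.exp (-(k * Real.pi ^ 2 / (8 * h))) := by
  have hn : 5 ≤ n := by omega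
  have hnR : (5 : ℝ) ≤ n := by exact_mod_cast hn
  have hkR : (2 : ℝ) ≤ k := by exact_mod_cast hk
  have hk0 : (0 : ℝ) < k := by linarith
  have hknR : 2 * (k : ℝ) ≤ n := by exact_mod_cast hkn.le
  have hh1 : 3 / 2 ≤ h := hh ▸ log_bounds hn
  have hh0 : 0 < h := by linarith
  have hδ0 : 0 < δ := by rw [hδ]; positivity
  have hpi := Real.pi_pos
  have hpi2 := Real.pi_lt_d2
  refine (prod_tanh_le hδ0 (by omega)).trans ?_
  have e1 : Real.pi ^ 2 / (4 * δ) = k * Real.pi ^ 2 / (8 * h) := by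
    rw [hδ]; field_simp; norm_num
  have e2 : 2 * Real.exp (-(k * Real.pi ^ 2 / (8 * h))) =
      Real.exp (Real.log 2 - k * Real.pi ^ 2 / (8 * h)) := by
    rw [sub_eq_add_neg, Real.exp_add, Real.exp_log two_pos]
  rw [e2, e1]
  refine Real.exp_le_exp.2 ?_
  have e3 : (k - 1 / 2) * δ = 2 * h - h / k := by rw [hδ]; field_simp
  have hhk : h / k ≤ h / 2 := div_le_div_of_nonneg_left hh0.le two_pos hkR
  have hx : Real.exp (-h) = Real.pi / (4 * n) := hh ▸ exp_neg_log_eq hn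
  have hx2 : Real.exp (-(h / 2)) ≤ 2 / 5 := by
    have h1 : Real.exp (-(h / 2)) ^ 2 = Real.exp (-h) := by
      rw [← Real.exp_nat_mul]; congr 1; push_cast; ring
    have h2 : Real.exp (-h) ≤ (2 / 5) ^ 2 := by
      rw [hx, div_le_iff₀ (by positivity)]
      nlinarith
    exact le_of_sq_le_sq (h1 ▸ h2) (by norm_num)
  have h4 : Real.exp (-((k - 1 / 2) * δ)) ≤ Real.pi / (4 * n) * (2 / 5) := by
    rw [e3, ← hx]
    calc Real.exp (-(2 * h - h / k)) ≤ Real.exp (-h + -(h / 2)) :=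
          Real.exp_le_exp.2 (by linarith)
      _ = Real.exp (-h) * Real.exp (-(h / 2)) := Real.exp_add _ _
      _ ≤ _ := mul_le_mul_of_nonneg_left hx2 (Real.exp_pos _).le
  -- Together with the 1/2 from the singular end this stays below log 2. Hence the factor 2, whose
  -- fourth power is the constant 16.
  have h5 : k * Real.pi ^ 2 / (8 * h) * Real.exp (-((k - 1 / 2) * δ)) ≤ 0.15 := by
    calc _ ≤ k * Real.pi ^ 2 / (8 * h) * (Real.pi / (4 * n) * (2 / 5)) :=
          mul_le_mul_of_nonneg_left h4 (by positivity)
      _ = (k * Real.pi ^ 3) / (80 * (h * n)) := by field_simp; norm_num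
      _ ≤ 0.15 := by
        rw [div_le_iff₀ (by positivity)]
        have hp3 : Real.pi ^ 3 ≤ 32 := by
          calc Real.pi ^ 3 ≤ 3.15 ^ 3 := pow_le_pow_left₀ hpi.le hpi2.le 3
            _ ≤ 32 := by norm_num
        have hb : 3 / 2 * (2 * (k : ℝ)) ≤ h * n := by
          apply mul_le_mul hh1 hknR <;> linarith
        nlinarith
  have := Real.log_two_gt_d9
  linarith

/-- The half-line shift data satisfy the separation condition on the roots of `z ^ n = -1`. -/
theorem separation_condition {n : ℕ} (hn : 5 ≤ n) {h c : ℝ}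
    (hh : h = Real.log (4 * n / Real.pi))
    (hc : c = (1 + Real.exp (-(2 * h))) / (1 - Real.exp (-(2 * h)))) :
    c ^ 2 * (1 + Real.cos (Real.pi / n)) ≤ 2 := by
  have hnR : (5 : ℝ) ≤ n := by exact_mod_cast hn
  have hpi := Real.pi_pos
  have hpi2 := Real.pi_lt_d2
  set x := Real.pi / (2 * n) with hx
  have hx0 : 0 < x := by positivity
  have hx1 : x ≤ 1 / 2 := by rw [hx, div_le_iff₀ (by positivity)]; nlinarith
  have hρ : Real.exp (-(2 * h)) = x ^ 2 / 4 := by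
    have h1 : Real.exp (-(2 * h)) = Real.exp (-h) ^ 2 := by
      rw [← Real.exp_nat_mul]; congr 1; push_cast; ring
    have h2 : Real.exp (-h) = x / 2 := by
      rw [hh, exp_neg_log_eq hn, hx]; field_simp; norm_num
    rw [h1, h2]; ring
  have e : Real.pi / n = 2 * x := by rw [hx]; field_simp
  -- Since 1 + cos 2x = 2 cos² x, the claim is the square of c cos x ≤ 1 with c = (1 + x²/4)/(1 -
  -- x²/4); the Taylor bound for cos with quartic remainder suffices.
  rw [e, Real.cos_two_mul, hc, hρ]
  have hcos := (abs_le.1 (Real.cos_bound (x := x) (by rw [abs_of_pos hx0]; linarith))).2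
  rw [abs_of_pos hx0] at hcos
  have hcos0 : 0 < Real.cos x :=
    Real.cos_pos_of_mem_Ioo ⟨by linarith, by linarith [Real.pi_gt_three]⟩
  have hx2 : x ^ 2 ≤ 1 / 4 := by nlinarith
  have hden : 0 < 1 - x ^ 2 / 4 := by linarith
  have hprod : (1 + x ^ 2 / 4) * Real.cos x ≤ 1 - x ^ 2 / 4 := by
    set u := x ^ 2 with hu
    have hu4 : x ^ 4 = u ^ 2 := by rw [hu]; ring
    rw [hu4] at hcos
    have hu0 : 0 ≤ u := sq_nonneg x
    have h1 : Real.cos x ≤ 1 - u / 2 + u ^ 2 * (5 / 96) := by linarith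
    have h2 := mul_le_mul_of_nonneg_left h1 (show 0 ≤ 1 + u / 4 by linarith)
    nlinarith [mul_nonneg (sq_nonneg u) (show 0 ≤ 1 / 4 - u by linarith), sq_nonneg u]
  have hq : (1 + x ^ 2 / 4) / (1 - x ^ 2 / 4) * Real.cos x ≤ 1 := by
    rw [div_mul_eq_mul_div, div_le_one hden]; exact hprod
  have hq0 : 0 ≤ (1 + x ^ 2 / 4) / (1 - x ^ 2 / 4) * Real.cos x := by positivity
  have := mul_le_mul hq hq hq0 zero_le_one
  nlinarith

/-- The rate for the half line is at least the rate for the whole line with half the size. -/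
theorem rate_comparison {n k : ℕ} (hk : 2 ≤ k) (hkn : 2 * k < n) :
    ((k : ℝ) - 1) / Real.log (8 * ((n / 2 : ℕ) : ℝ) / Real.pi) ≤
      k / Real.log (4 * n / Real.pi) := by
  have hn : 5 ≤ n := by omega
  have hnR : (5 : ℝ) ≤ n := by exact_mod_cast hn
  have hkR : (2 : ℝ) ≤ k := by exact_mod_cast hk
  have hknR : 2 * (k : ℝ) + 1 ≤ n := by exact_mod_cast hkn
  have hpi := Real.pi_pos
  have hpi2 := Real.pi_lt_d2
  have hh := log_bounds hn
  have hm : ((n : ℝ) - 1) / 2 ≤ ((n / 2 : ℕ) : ℝ) := by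
    have : n - 1 ≤ 2 * (n / 2) := by omega
    have h2 : ((n - 1 : ℕ) : ℝ) ≤ ((2 * (n / 2) : ℕ) : ℝ) := by exact_mod_cast this
    rw [Nat.cast_sub (by omega)] at h2
    push_cast at h2 ⊢
    linarith
  have hΛ0 : Real.log (4 * (n - 1) / Real.pi) ≤ Real.log (8 * ((n / 2 : ℕ) : ℝ) / Real.pi) := by
    refine Real.log_le_log (div_pos (by linarith) hpi) ?_
    refine div_le_div_of_nonneg_right ?_ hpi.le
    linarith
  -- Since 8⌊n/2⌋ may be as small as 4(n - 1), the logarithm can drop by up to 1/(2k). Replacing k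
  -- by k - 1 on the left leaves a whole logarithm to pay for this.
  have hsplit : Real.log (4 * n / Real.pi) =
      Real.log (4 * (n - 1) / Real.pi) + Real.log (n / (n - 1)) := by
    have h1 : (n : ℝ) - 1 ≠ 0 := by linarith
    rw [← Real.log_mul (by positivity) (by positivity)]
    congr 1
    field_simp
  have hlog : Real.log (n / (n - 1)) ≤ 1 / (2 * k) := by
    have h1 : (0 : ℝ) < n - 1 := by linarith
    have h2 := Real.log_le_sub_one_of_pos (show (0 : ℝ) < n / (n - 1) by positivity)
    have h3 : (n : ℝ) / (n - 1) - 1 = 1 / (n - 1) := by field_simp; ring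
    rw [h3] at h2
    exact h2.trans (one_div_le_one_div_of_le (by linarith) (by linarith))
  have hk1 : (1 : ℝ) / (2 * k) ≤ 1 / 4 := one_div_le_one_div_of_le (by norm_num) (by linarith)
  have hkk : (k : ℝ) * (1 / (2 * k)) = 1 / 2 := by field_simp
  rw [div_le_div_iff₀ (by linarith) (by linarith)]
  nlinarith

/-- Eigenvalue decay for a positive semidefinite Hankel matrix with a representing measure on the
half line. -/
theorem sortedEigenvalue_hankel_le {n : ℕ} {K : Matrix (Fin n) (Fin n) ℝ} {ι : Type*}
    [Fintype ι] {w θ : ι → ℝ} (hK : K.IsHermitian) (hn : 0 < n)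
    (hKw : ∀ i j : Fin n, K i j = ∑ l, w l * θ l ^ ((i : ℕ) + j)) (hw : ∀ l, 0 ≤ w l)
    (hθ : ∀ l, 0 ≤ θ l) (h0 : 0 ≤ sortedEigenvalue hK ⟨0, hn⟩) (k : ℕ) (hk : 2 * k < n) :
    sortedEigenvalue hK ⟨2 * k, hk⟩ ≤
      16 * Real.exp (Real.pi ^ 2 / (4 * Real.log (8 * ((n / 2 : ℕ) : ℝ) / Real.pi)))
        ^ (-2 * (k : ℤ) + 2) * sortedEigenvalue hK ⟨0, hn⟩ := by
  have hpi := Real.pi_pos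
  rcases lt_or_ge k 2 with hk2 | hk2
  -- For k ≤ 1 the exponent -2k + 2 is nonnegative and the bracket is at least 1, so the ordering of
  -- the eigenvalues is enough.
  · have hle : sortedEigenvalue hK ⟨2 * k, hk⟩ ≤ sortedEigenvalue hK ⟨0, hn⟩ :=
      sortedEigenvalue_antitone hK (by simp [Fin.le_def])
    refine hle.trans (le_mul_of_one_le_left h0 ?_)
    have hlog : 0 ≤ Real.log (8 * ((n / 2 : ℕ) : ℝ) / Real.pi) := by
      rcases Nat.eq_zero_or_pos (n / 2) with h | h
      -- For n = 1 the argument of the logarithm is 0; with `Real.log 0 = 0` and division by zero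
      -- the bracket becomes 1, as the statement prescribes.
      · simp [h]
      · apply Real.log_nonneg
        rw [le_div_iff₀ hpi]
        have : (1 : ℝ) ≤ ((n / 2 : ℕ) : ℝ) := by exact_mod_cast h
        linarith [Real.pi_lt_d2]
    have h1 : (1 : ℝ) ≤ Real.exp (Real.pi ^ 2 /
        (4 * Real.log (8 * ((n / 2 : ℕ) : ℝ) / Real.pi))) :=
      Real.one_le_exp (by positivity)
    have h2 := one_le_zpow₀ h1 (n := -2 * (k : ℤ) + 2) (by omega)
    linarith
  · have hn5 : 5 ≤ n := by omega
    set h := Real.log (4 * n / Real.pi) with hh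
    -- The shifts are the midpoints of k equal cells of [0, 2h] = [0, -log ρ] on the logarithmic
    -- scale.
    set δ := 2 * h / k with hδ
    set ρ := Real.exp (-(2 * h)) with hρ
    have hkR : (2 : ℝ) ≤ k := by exact_mod_cast hk2
    have hh0 : 0 < h := by linarith [log_bounds hn5]
    have hδ0 : 0 < δ := by positivity
    have hρ0 : 0 < ρ := Real.exp_pos _
    have hρ1 : ρ < 1 := by rw [hρ, Real.exp_lt_one_iff]; linarith
    have hkδ : k * δ = 2 * h := by rw [hδ]; field_simp
    have hρ1' : 0 < 1 - ρ := by linarith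
    have hM : ∀ y, ρ ≤ y → y ≤ 1 → ∏ i : Fin k,
        (|y - Real.exp (-(((i : ℕ) + 1 / 2) * δ))| / (y + Real.exp (-(((i : ℕ) + 1 / 2) * δ)))) ≤
        2 * Real.exp (-(k * Real.pi ^ 2 / (8 * h))) := fun y hy0 hy1 =>
      (prod_abs_sub_div_le hδ0 (by rw [hkδ]; exact hy0) hy1 (by omega)).trans
        (prod_tanh_le_two_mul hk2 hk hh hδ)
    have key := sortedEigenvalue_le_of_shifts hK hn hKw hw hθ h0 hk
      (fun i : Fin k => Real.exp (-(((i : ℕ) + 1 / 2) * δ))) ((1 + ρ) / (1 - ρ)) ρ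
      (2 * Real.exp (-(k * Real.pi ^ 2 / (8 * h))))
      (by rw [lt_div_iff₀ hρ1']; linarith) (by field_simp; ring)
      (fun i => Real.exp_pos _) hM (separation_condition hn5 hh rfl)
    refine key.trans (mul_le_mul_of_nonneg_right ?_ h0)
    rw [mul_pow, ← Real.exp_nat_mul, ← Real.rpow_intCast, ← Real.exp_mul]
    norm_num
    have hrate := rate_comparison hk2 hk
    rw [← hh] at hrate
    have h2 := mul_le_mul_of_nonneg_left hrate (show 0 ≤ Real.pi ^ 2 / 2 by positivity)
    set Λ := Real.log (8 * ((n / 2 : ℕ) : ℝ) / Real.pi)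
    have e1 : 4 * (k * Real.pi ^ 2 / (8 * h)) = Real.pi ^ 2 / 2 * (k / h) := by
      field_simp; norm_num
    have e2 : Real.pi ^ 2 / (4 * Λ) * (-(2 * k) + 2) = -(Real.pi ^ 2 / 2 * ((k - 1) / Λ)) := by
      rw [div_mul_eq_mul_div, mul_div_assoc', div_mul_eq_mul_div, div_div, ← neg_div]
      rw [show (4 : ℝ) * Λ = 2 * (2 * Λ) by ring,
        show Real.pi ^ 2 * (-(2 * k) + 2) = 2 * (-(Real.pi ^ 2 * (k - 1))) by ring,
        mul_div_mul_left _ _ two_ne_zero]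
    linarith

end HankelDecay

/-! ### Exponential smallness of the last eigenvalue -/

section SmallestEigenvalue

open Matrix Polynomial

/-- If all but `m` of the nodes of the representing measure are at most `exp (-7/4)`, the smallest
eigenvalue of the Hankel matrix decays like `exp (-7 n / 2)`. -/
theorem sortedEigenvalue_last_le_exp {n : ℕ} {K : Matrix (Fin n) (Fin n) ℝ} {ι : Type*}
    [Fintype ι] {w θ : ι → ℝ} (hK : K.IsHermitian) (hn : 0 < n)
    (hKw : ∀ i j : Fin n, K i j = ∑ l, w l * θ l ^ ((i : ℕ) + j)) (hw : ∀ l, 0 ≤ w l)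
    (hθ : ∀ l, 0 ≤ θ l) {L : ℝ} (hL : 1 ≤ L) (hθL : ∀ l, θ l ≤ L) {m : ℕ}
    (hm : (Finset.univ.filter fun l => Real.exp (-(7 / 4)) < θ l).card ≤ m) :
    sortedEigenvalue hK ⟨n - 1, by omega⟩ ≤
      Real.exp (7 * (m + 2) / 2) * L ^ (2 * m) * Real.exp (-(7 * ((n : ℝ) + 1) / 2)) *
        ∑ l, w l := by
  set bad := Finset.univ.filter fun l => Real.exp (-(7 / 4)) < θ l with hbad
  have hS : 0 ≤ ∑ l, w l := Finset.sum_nonneg fun l _ => hw l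
  have hE : Real.exp (7 * (m + 2) / 2) * L ^ (2 * m) * Real.exp (-(7 * ((n : ℝ) + 1) / 2)) =
      Real.exp (7 * (m + 1 - n) / 2) * L ^ (2 * m) := by
    rw [mul_right_comm, ← Real.exp_add]
    congr 2
    ring
  rw [hE]
  rcases lt_or_ge bad.card n with hs | hs
  · have hcast : ((n - 1 - bad.card : ℕ) : ℝ) = n - 1 - bad.card := by
      rw [Nat.cast_sub (by omega), Nat.cast_sub (by omega)]; simp
    -- The product removes the large nodes. The power of X uses the remaining degree, each unit of
    -- which gains exp(-7/4), hence exp(-7/2) after squaring.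
    have hmon : (X ^ (n - 1 - bad.card) * ∏ l ∈ bad, (X - C (θ l))).Monic :=
      (monic_X_pow _).mul (monic_prod_of_monic _ _ fun l _ => monic_X_sub_C _)
    refine (sortedEigenvalue_last_le hK hn hKw hw _ hmon ?_
      (Real.exp (7 * (bad.card + 1 - n) / 2) * L ^ (2 * bad.card)) (by positivity) ?_).trans ?_
    · rw [(monic_X_pow _).natDegree_mul (monic_prod_of_monic _ _ fun l _ => monic_X_sub_C _),
        natDegree_X_pow, natDegree_finsetProd_X_sub_C_eq_card]
      omega
    · intro l
      rw [eval_mul, eval_pow, eval_X, eval_prod]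
      by_cases hl : l ∈ bad
      · rw [Finset.prod_eq_zero hl (by simp)]
        rw [mul_zero, zero_pow two_ne_zero]
        positivity
      · have hl' : θ l ≤ Real.exp (-(7 / 4)) := by simpa [hbad] using hl
        have h1 : θ l ^ (n - 1 - bad.card) ≤ Real.exp (7 * (bad.card + 1 - n) / 4) := by
          refine (pow_le_pow_left₀ (hθ l) hl' _).trans_eq ?_
          rw [← Real.exp_nat_mul, hcast]
          congr 1
          ring
        have h2 : |∏ l' ∈ bad, (X - C (θ l')).eval (θ l)| ≤ L ^ bad.card := by
          rw [Finset.abs_prod]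
          refine (Finset.prod_le_prod (fun _ _ => abs_nonneg _) fun l' _ => ?_).trans_eq
            (Finset.prod_const L)
          rw [eval_sub, eval_X, eval_C, abs_le]
          constructor <;> linarith [hθ l, hθ l', hθL l, hθL l']
        rw [← sq_abs, abs_mul, abs_of_nonneg (pow_nonneg (hθ l) _)]
        refine (pow_le_pow_left₀ (mul_nonneg (pow_nonneg (hθ l) _) (abs_nonneg _))
          (mul_le_mul h1 h2 (abs_nonneg _) (Real.exp_pos _).le) 2).trans_eq ?_
        rw [mul_pow, ← Real.exp_nat_mul, ← pow_mul, mul_comm bad.card 2]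
        congr 2
        push_cast
        ring
    · refine mul_le_mul_of_nonneg_right ?_ hS
      have hsm : (bad.card : ℝ) ≤ m := by exact_mod_cast hm
      refine mul_le_mul (Real.exp_le_exp.2 (by linarith))
        (pow_le_pow_right₀ hL (by omega)) (by positivity) (by positivity)
  -- Now n ≤ m, the prefactor is at least 1, and the constant polynomial suffices.
  · refine (sortedEigenvalue_last_le hK hn hKw hw 1 monic_one (by simpa using hn) 1
      zero_le_one (by simp)).trans (mul_le_mul_of_nonneg_right ?_ hS)
    have hnm : (n : ℝ) ≤ m := by exact_mod_cast hs.trans hm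
    have h1 : 1 ≤ Real.exp (7 * (m + 1 - n) / 2) := Real.one_le_exp (by linarith)
    have h2 : 1 ≤ L ^ (2 * m) := one_le_pow₀ hL
    nlinarith

end SmallestEigenvalue

/-! ### Spectral measure of a Krylov sequence -/

section SpectralMeasure

variable {H F : Type*} [NormedAddCommGroup H] [InnerProductSpace ℝ H] [NormedAddCommGroup F]
  [InnerProductSpace ℝ F] [CompleteSpace F]

/-- The representing measure of the Gram matrix of a Krylov sequence. -/
theorem exists_spectral_measure {ν : ℝ} (hν : 0 < ν) {n : ℕ} (hn : 0 < n) (x : ℕ → H) (y : ℕ → F)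
    (hx : LinearIndependent ℝ fun i : Fin n => x i)
    (hxy : ∀ i j, i + 1 < n → j < n → ν * inner ℝ (x (i + 1)) (x j) = inner ℝ (y i) (y j)) :
    ∃ w θ : Fin n → ℝ, (∀ l, 0 ≤ w l) ∧ (∀ l, 0 ≤ θ l) ∧
      (∀ i j : Fin n, ν * inner ℝ (x i) (x j) = ∑ l, w l * θ l ^ ((i : ℕ) + j)) ∧
      ∃ T : (Fin n → ℝ) →ₗ[ℝ] (Fin n → ℝ), ∀ c,
        ‖∑ i, T c i • x i‖ ^ 2 = ∑ l, c l ^ 2 ∧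
        ‖∑ i, T c i • y i‖ ^ 2 = ν * ∑ l, θ l * c l ^ 2 := by
  set W := Submodule.span ℝ (Set.range fun i : Fin n => x i)
  set b : Module.Basis (Fin n) ℝ W := Module.Basis.span hx with hb
  have hbx : ∀ i, (b i : H) = x i := fun i => by rw [hb, Module.Basis.span_apply]
  have : FiniteDimensional ℝ W := b.finiteDimensional_of_finite
  have hfr : Module.finrank ℝ W = n := by
    rw [Module.finrank_eq_card_basis b, Fintype.card_fin]
  set J : W →L[ℝ] F := LinearMap.toContinuousLinearMap (b.constr ℝ fun i => y i) with hJ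
  have hJb : ∀ i, J (b i) = y i := fun i => b.constr_basis ℝ _ i
  set S : W →L[ℝ] W := ν⁻¹ • (J.adjoint ∘L J) with hS
  have hSin : ∀ v z : W, inner ℝ (S v) z = ν⁻¹ * inner ℝ (J v) (J z) := by
    intro v z
    simp [hS, inner_smul_left, ContinuousLinearMap.adjoint_inner_left]
  have hsym : (S : W →ₗ[ℝ] W).IsSymmetric := by
    intro v z
    change inner ℝ (S v) z = inner ℝ v (S z)
    rw [hSin, real_inner_comm (S z) v, hSin, real_inner_comm]
  set e := hsym.eigenvectorBasis hfr
  set θ := hsym.eigenvalues hfr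
  have hSe : ∀ l, S (e l) = θ l • e l := fun l => by
    exact hsym.apply_eigenvectorBasis hfr l
  have hJe : ∀ l l', inner ℝ (J (e l)) (J (e l')) = ν * (if l = l' then θ l else 0) := by
    intro l l'
    have h := hSin (e l) (e l')
    rw [hSe, inner_smul_left, orthonormal_iff_ite.1 e.orthonormal] at h
    have h2 : inner ℝ (J (e l)) (J (e l')) = ν * (ν⁻¹ * inner ℝ (J (e l)) (J (e l'))) := by
      field_simp
    rw [h2, ← h]
    simp
  have hθ : ∀ l, 0 ≤ θ l := by
    intro l
    have h := hJe l l
    rw [if_pos rfl, real_inner_self_eq_norm_sq] at h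
    exact nonneg_of_mul_nonneg_right (h ▸ sq_nonneg _) hν
  -- The hypothesis fixes the inner products of S(b i) with the basis, so S is the shift as long as
  -- the next vector still lies in the span.
  have hstep : ∀ i (hi : i + 1 < n), S (b ⟨i, by omega⟩) = b ⟨i + 1, hi⟩ := by
    intro i hi
    refine InnerProductSpace.ext_inner_right_basis b fun j => ?_
    rw [hSin, hJb, hJb, ← hxy i j hi j.2, Submodule.coe_inner, hbx, hbx]
    field_simp
  have hcoef : ∀ l i (hi : i < n), inner ℝ (e l) (b ⟨i, hi⟩) =
      θ l ^ i * inner ℝ (e l) (b ⟨0, hn⟩) := by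
    intro l i
    induction i with
    | zero => intro hi; simp
    | succ i ih =>
      intro hi
      rw [← hstep i hi]
      have : inner ℝ (e l) (S (b ⟨i, by omega⟩)) = inner ℝ (S (e l)) (b ⟨i, by omega⟩) :=
        (hsym _ _).symm
      rw [this, hSe, inner_smul_left, ih]
      simp only [conj_trivial]
      ring
  refine ⟨fun l => ν * inner ℝ (e l) (b ⟨0, hn⟩) ^ 2, θ, fun l => by positivity, hθ, ?_, ?_⟩
  · intro i j
    rw [← hbx, ← hbx, ← Submodule.coe_inner, ← e.sum_inner_mul_inner, Finset.mul_sum]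
    refine Finset.sum_congr rfl fun l _ => ?_
    rw [real_inner_comm, hcoef l i i.2, hcoef l j j.2]
    ring
  -- T rewrites eigenvector coordinates in the Krylov basis, so that spectral nodes can be tested by
  -- actual velocity fields.
  · refine ⟨b.equivFun.toLinearMap ∘ₗ Fintype.linearCombination ℝ (fun l => e l), fun c => ?_⟩
    set z : W := ∑ l, c l • e l with hz
    have hT : (b.equivFun.toLinearMap ∘ₗ Fintype.linearCombination ℝ (fun l => e l)) c =
        b.equivFun z := by
      simp [Fintype.linearCombination_apply, hz]
    rw [hT]
    have hsum : ∑ i, b.equivFun z i • b i = z := b.sum_equivFun z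
    constructor
    · have h1 : ∑ i, b.equivFun z i • x i = (z : H) := by
        rw [← hsum, Submodule.coe_sum]
        simp only [hsum, Submodule.coe_smul, hbx]
      rw [h1, Submodule.norm_coe, ← real_inner_self_eq_norm_sq, hz, e.orthonormal.inner_sum]
      simp [sq]
    · have h1 : ∑ i, b.equivFun z i • y i = J z := by
        conv_rhs => rw [← hsum, map_sum]
        simp only [map_smul, hJb]
      rw [h1, hz, ← real_inner_self_eq_norm_sq, map_sum, sum_inner, Finset.mul_sum]
      refine Finset.sum_congr rfl fun l _ => ?_
      rw [inner_sum]
      simp only [map_smul, inner_smul_left, inner_smul_right, hJe]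
      simp
      ring

end SpectralMeasure

/-! ### Differences along a segment -/

section Segment

variable {E F : Type*} [NormedAddCommGroup E] [NormedSpace ℝ E] [NormedAddCommGroup F]
  [NormedSpace ℝ F] [CompleteSpace F]

theorem sq_integral_le_integral_sq {f : ℝ → ℝ} (hf : Continuous f) :
    (∫ t in (0 : ℝ)..1, f t) ^ 2 ≤ ∫ t in (0 : ℝ)..1, f t ^ 2 := by
  set m := ∫ t in (0 : ℝ)..1, f t with hm
  have h0 : 0 ≤ ∫ t in (0 : ℝ)..1, (f t - m) ^ 2 :=
    intervalIntegral.integral_nonneg zero_le_one fun t _ => sq_nonneg _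
  have h1 : ∫ t in (0 : ℝ)..1, (f t - m) ^ 2 = (∫ t in (0 : ℝ)..1, f t ^ 2) - m ^ 2 := by
    have e : ∀ t, (f t - m) ^ 2 = f t ^ 2 - (2 * m) * f t + m ^ 2 := fun t => by ring
    simp_rw [e]
    rw [intervalIntegral.integral_add, intervalIntegral.integral_sub,
      intervalIntegral.integral_const_mul, ← hm]
    · simp; ring
    all_goals exact Continuous.intervalIntegrable (by fun_prop) _ _
  linarith

/-- Fundamental theorem of calculus and Cauchy–Schwarz. The lower integral allows Tonelli later
without integrability conditions. -/
theorem norm_sub_sq_le_lintegral {φ : E → F} (hφ : ContDiff ℝ 1 φ) {D : ℝ} {x y : E}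
    (hxy : ‖x - y‖ ≤ D) :
    ENNReal.ofReal (‖φ x - φ y‖ ^ 2) ≤ ENNReal.ofReal (D ^ 2) *
      ∫⁻ t in Set.Ioc (0 : ℝ) 1, ENNReal.ofReal (‖fderiv ℝ φ (t • x + (1 - t) • y)‖ ^ 2) := by
  set γ : ℝ → E := fun t => t • x + (1 - t) • y with hγ
  have hD : Continuous (fderiv ℝ φ) := hφ.continuous_fderiv one_ne_zero
  have hγc : Continuous γ := by fun_prop
  have hγd : ∀ t, HasDerivAt γ (x - y) t := by
    intro t
    have h := ((hasDerivAt_id t).smul_const x).add (((hasDerivAt_id t).const_sub 1).smul_const y)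
    convert! h using 1
    simp [sub_eq_add_neg]
  have hd : ∀ t, HasDerivAt (fun t => φ (γ t)) (fderiv ℝ φ (γ t) (x - y)) t := fun t =>
    ((hφ.differentiable one_ne_zero (γ t)).hasFDerivAt).comp_hasDerivAt t (hγd t)
  have hint : ∫ t in (0 : ℝ)..1, fderiv ℝ φ (γ t) (x - y) = φ x - φ y := by
    rw [intervalIntegral.integral_eq_sub_of_hasDerivAt (fun t _ => hd t)
      (Continuous.intervalIntegrable (by fun_prop) _ _)]
    simp [hγ]
  have hD0 : 0 ≤ D := (norm_nonneg _).trans hxy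
  have h1 : ‖φ x - φ y‖ ≤ ∫ t in (0 : ℝ)..1, ‖fderiv ℝ φ (γ t)‖ * D := by
    rw [← hint]
    refine intervalIntegral.norm_integral_le_of_norm_le zero_le_one
      (Filter.Eventually.of_forall fun t _ => ?_)
      (Continuous.intervalIntegrable (by fun_prop) _ _)
    exact (ContinuousLinearMap.le_opNorm _ _).trans
      (mul_le_mul_of_nonneg_left hxy (norm_nonneg _))
  rw [intervalIntegral.integral_mul_const] at h1
  have h2 : ‖φ x - φ y‖ ^ 2 ≤ D ^ 2 * ∫ t in (0 : ℝ)..1, ‖fderiv ℝ φ (γ t)‖ ^ 2 := by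
    refine (pow_le_pow_left₀ (norm_nonneg _) h1 2).trans ?_
    rw [mul_pow, mul_comm]
    exact mul_le_mul_of_nonneg_left
      (sq_integral_le_integral_sq (f := fun t => ‖fderiv ℝ φ (γ t)‖) (by fun_prop)) (sq_nonneg D)
  have h3 : ∫⁻ t in Set.Ioc (0 : ℝ) 1, ENNReal.ofReal (‖fderiv ℝ φ (γ t)‖ ^ 2) =
      ENNReal.ofReal (∫ t in (0 : ℝ)..1, ‖fderiv ℝ φ (γ t)‖ ^ 2) := by
    rw [intervalIntegral.integral_of_le zero_le_one, ofReal_integral_eq_lintegral_ofReal]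
    · exact (Continuous.integrableOn_Icc (by fun_prop)).mono_set Set.Ioc_subset_Icc_self
    · exact Filter.Eventually.of_forall fun t => sq_nonneg _
  rw [h3, ← ENNReal.ofReal_mul (sq_nonneg D)]
  exact ENNReal.ofReal_le_ofReal h2

end Segment

/-! ### Poincaré–Wirtinger on convex sets -/

section Poincare

variable {E F : Type*} [NormedAddCommGroup E] [NormedSpace ℝ E] [FiniteDimensional ℝ E]
  [MeasurableSpace E] [BorelSpace E] [NormedAddCommGroup F] [InnerProductSpace ℝ F]
  [FiniteDimensional ℝ F] {μ : Measure E} [μ.IsAddHaarMeasure]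

theorem setLIntegral_comp_smul_add_le {s : ℝ} (hs : 1 / 2 ≤ s) (b : E) {Q : Set E}
    (hQ : MeasurableSet Q) (hsQ : ∀ x ∈ Q, s • x + b ∈ Q) {G : E → ENNReal} (hG : Measurable G) :
    ∫⁻ x in Q, G (s • x + b) ∂μ ≤ 2 ^ Module.finrank ℝ E * ∫⁻ x in Q, G x ∂μ := by
  have hs0 : 0 < s := by linarith
  have hGQ : Measurable (Q.indicator G) := hG.indicator hQ
  calc ∫⁻ x in Q, G (s • x + b) ∂μ ≤ ∫⁻ x, Q.indicator G (s • x + b) ∂μ := by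
        rw [← lintegral_indicator hQ]
        refine lintegral_mono fun x => ?_
        by_cases hx : x ∈ Q
        · simp [hx, hsQ x hx]
        · simp [hx]
    _ = ∫⁻ z, Q.indicator G (z + b) ∂(μ.map (s • ·)) := by
        rw [lintegral_map (by fun_prop) (by fun_prop)]
    _ = ENNReal.ofReal |(s ^ Module.finrank ℝ E)⁻¹| * ∫⁻ z, Q.indicator G z ∂μ := by
        rw [Measure.map_addHaar_smul μ hs0.ne', lintegral_smul_measure,
          lintegral_add_right_eq_self, smul_eq_mul]
    _ ≤ 2 ^ Module.finrank ℝ E * ∫⁻ x in Q, G x ∂μ := by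
        rw [lintegral_indicator hQ]
        gcongr
        rw [abs_of_pos (by positivity), ← inv_pow]
        have h2 : s⁻¹ ≤ 2 := by
          rw [inv_le_comm₀ hs0 two_pos]; linarith
        calc ENNReal.ofReal (s⁻¹ ^ Module.finrank ℝ E)
            ≤ ENNReal.ofReal (2 ^ Module.finrank ℝ E) :=
              ENNReal.ofReal_le_ofReal (pow_le_pow_left₀ (by positivity) h2 _)
          _ = _ := by rw [ENNReal.ofReal_pow (by norm_num)]; simp

/-- Of t and 1 - t one is at least 1/2. Substituting in the variable it multiplies keeps the
Jacobian factor below 2^dim, and convexity keeps the image in Q. -/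
theorem lintegral_lintegral_segment_le {t : ℝ} (ht : t ∈ Set.Icc (0 : ℝ) 1) {Q : Set E}
    (hQ : MeasurableSet Q) (hQc : Convex ℝ Q) {G : E → ENNReal} (hG : Measurable G) :
    ∫⁻ x in Q, ∫⁻ y in Q, G (t • x + (1 - t) • y) ∂μ ∂μ ≤
      2 ^ Module.finrank ℝ E * μ Q * ∫⁻ x in Q, G x ∂μ := by
  have hconst : ∫⁻ _ in Q, (2 ^ Module.finrank ℝ E * ∫⁻ x in Q, G x ∂μ) ∂μ =
      2 ^ Module.finrank ℝ E * μ Q * ∫⁻ x in Q, G x ∂μ := by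
    rw [lintegral_const, Measure.restrict_apply_univ]
    ring
  rcases le_total (1 / 2) t with h | h
  · rw [lintegral_lintegral_swap (Measurable.aemeasurable (by fun_prop)), ← hconst]
    refine setLIntegral_mono measurable_const fun y hy => ?_
    exact setLIntegral_comp_smul_add_le h _ hQ
      (fun x hx => hQc hx hy ht.1 (by linarith [ht.2]) (by ring)) hG
  · rw [← hconst]
    refine setLIntegral_mono measurable_const fun x hx => ?_
    simp_rw [add_comm (t • x)]
    exact setLIntegral_comp_smul_add_le (by linarith) _ hQ
      (fun y hy => hQc hy hx (by linarith [ht.2]) ht.1 (by ring)) hG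

theorem lintegral_lintegral_norm_sub_sq_le {φ : E → F} (hφ : ContDiff ℝ 1 φ) {D : ℝ}
    {Q : Set E} (hQ : MeasurableSet Q) (hQc : Convex ℝ Q)
    (hQD : ∀ x ∈ Q, ∀ y ∈ Q, ‖x - y‖ ≤ D) :
    ∫⁻ x in Q, ∫⁻ y in Q, ENNReal.ofReal (‖φ x - φ y‖ ^ 2) ∂μ ∂μ ≤
      ENNReal.ofReal (D ^ 2) * (2 ^ Module.finrank ℝ E * μ Q *
        ∫⁻ x in Q, ENNReal.ofReal (‖fderiv ℝ φ x‖ ^ 2) ∂μ) := by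
  set G : E → ENNReal := fun z => ENNReal.ofReal (‖fderiv ℝ φ z‖ ^ 2) with hGdef
  have hDc : Continuous (fderiv ℝ φ) := hφ.continuous_fderiv one_ne_zero
  have hGc : Continuous G := ENNReal.continuous_ofReal.comp (hDc.norm.pow 2)
  have hG : Measurable G := hGc.measurable
  calc ∫⁻ x in Q, ∫⁻ y in Q, ENNReal.ofReal (‖φ x - φ y‖ ^ 2) ∂μ ∂μ
      ≤ ∫⁻ x in Q, ∫⁻ y in Q, ENNReal.ofReal (D ^ 2) *
          (∫⁻ t in Set.Ioc (0 : ℝ) 1, G (t • x + (1 - t) • y)) ∂μ ∂μ := by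
        refine setLIntegral_mono' hQ fun x hx => setLIntegral_mono' hQ fun y hy => ?_
        exact norm_sub_sq_le_lintegral hφ (hQD x hx y hy)
    _ = ENNReal.ofReal (D ^ 2) * ∫⁻ x in Q, ∫⁻ y in Q,
          (∫⁻ t in Set.Ioc (0 : ℝ) 1, G (t • x + (1 - t) • y)) ∂μ ∂μ := by
        rw [← lintegral_const_mul' _ _ ENNReal.ofReal_ne_top]
        refine lintegral_congr fun x => ?_
        rw [← lintegral_const_mul' _ _ ENNReal.ofReal_ne_top]
    _ = ENNReal.ofReal (D ^ 2) * ∫⁻ t in Set.Ioc (0 : ℝ) 1, (∫⁻ x in Q, ∫⁻ y in Q,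
          G (t • x + (1 - t) • y) ∂μ ∂μ) := by
        congr 1
        have e : ∀ x, ∫⁻ y in Q, (∫⁻ t in Set.Ioc (0 : ℝ) 1, G (t • x + (1 - t) • y)) ∂μ =
            ∫⁻ t in Set.Ioc (0 : ℝ) 1, (∫⁻ y in Q, G (t • x + (1 - t) • y) ∂μ) := fun x => by
          refine lintegral_lintegral_swap (Measurable.aemeasurable ?_)
          have : Measurable fun q : E × ℝ => G (q.2 • x + (1 - q.2) • q.1) :=
            hG.comp (by fun_prop)
          exact this
        simp_rw [e]
        rw [lintegral_lintegral_swap]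
        refine Measurable.aemeasurable ?_
        have : Measurable fun q : (E × ℝ) × E => G (q.1.2 • q.1.1 + (1 - q.1.2) • q.2) :=
          hG.comp (by fun_prop)
        exact this.lintegral_prod_right'
    _ ≤ ENNReal.ofReal (D ^ 2) * ∫⁻ _ in Set.Ioc (0 : ℝ) 1,
          (2 ^ Module.finrank ℝ E * μ Q * ∫⁻ x in Q, G x ∂μ) := by
        gcongr ENNReal.ofReal (D ^ 2) * ?_
        refine setLIntegral_mono measurable_const fun t ht => ?_
        exact lintegral_lintegral_segment_le ⟨ht.1.le, ht.2⟩ hQ hQc hG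
    _ = _ := by
        rw [lintegral_const, Measure.restrict_apply_univ, Real.volume_Ioc]
        simp

/-- It introduces the mean in Poincaré–Wirtinger; nonnegativity of its left side also serves as
Cauchy–Schwarz for the mean in the Friedrichs inequality. -/
theorem integral_integral_norm_sub_sq {α : Type*} [MeasurableSpace α] {ρ : Measure α}
    [IsFiniteMeasure ρ] {φ : α → F} (h2 : MemLp φ 2 ρ) :
    ∫ x, ∫ y, ‖φ x - φ y‖ ^ 2 ∂ρ ∂ρ =
      2 * ρ.real Set.univ * (∫ x, ‖φ x‖ ^ 2 ∂ρ) - 2 * ‖∫ x, φ x ∂ρ‖ ^ 2 := by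
  have h1 : Integrable φ ρ := h2.integrable one_le_two
  have hsq : Integrable (fun x => ‖φ x‖ ^ 2) ρ := h2.norm.integrable_sq
  have e : ∀ x, ∫ y, ‖φ x - φ y‖ ^ 2 ∂ρ =
      ρ.real Set.univ * ‖φ x‖ ^ 2 - 2 * inner ℝ (φ x) (∫ y, φ y ∂ρ) + ∫ y, ‖φ y‖ ^ 2 ∂ρ := by
    intro x
    simp_rw [norm_sub_sq_real]
    have hi : Integrable (fun y => inner ℝ (φ x) (φ y)) ρ := h1.const_inner (φ x)
    rw [integral_add (by fun_prop) hsq, integral_sub (by fun_prop) (hi.const_mul 2),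
      integral_const_mul, integral_inner h1]
    simp
  simp_rw [e]
  have hi : Integrable (fun x => inner ℝ (φ x) (∫ y, φ y ∂ρ)) ρ := h1.inner_const _
  rw [integral_add (f := fun x => ρ.real Set.univ * ‖φ x‖ ^ 2 -
      2 * inner ℝ (φ x) (∫ y, φ y ∂ρ)) ((hsq.const_mul _).sub (hi.const_mul 2)) (by fun_prop),
    integral_sub (hsq.const_mul _) (hi.const_mul 2), integral_const_mul, integral_const_mul]
  have hi2 : ∫ x, inner ℝ (φ x) (∫ y, φ y ∂ρ) ∂ρ = ‖∫ y, φ y ∂ρ‖ ^ 2 := by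
    simp_rw [real_inner_comm (∫ y, φ y ∂ρ)]
    rw [integral_inner h1, real_inner_self_eq_norm_sq]
  rw [hi2]
  simp
  ring

/-- The Poincaré–Wirtinger inequality on a bounded convex set. -/
theorem measureReal_mul_integral_norm_sq_le {φ : E → F} (hφ : ContDiff ℝ 1 φ)
    (hφc : HasCompactSupport φ) {D : ℝ} {Q : Set E} (hQ : MeasurableSet Q) (hQc : Convex ℝ Q)
    (hQμ : μ Q ≠ ⊤) (hQD : ∀ x ∈ Q, ∀ y ∈ Q, ‖x - y‖ ≤ D) :
    μ.real Q * ∫ x in Q, ‖φ x‖ ^ 2 ∂μ ≤ ‖∫ x in Q, φ x ∂μ‖ ^ 2 +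
      D ^ 2 * 2 ^ Module.finrank ℝ E * μ.real Q * ∫ x in Q, ‖fderiv ℝ φ x‖ ^ 2 ∂μ := by
  have : IsFiniteMeasure (μ.restrict Q) := ⟨by simpa using hQμ.lt_top⟩
  have h2 : MemLp φ 2 (μ.restrict Q) :=
    (hφ.continuous.memLp_of_hasCompactSupport hφc).restrict Q
  have hdc : Continuous (fderiv ℝ φ) := hφ.continuous_fderiv one_ne_zero
  have hd2 : Integrable (fun x => ‖fderiv ℝ φ x‖ ^ 2) (μ.restrict Q) :=
    ((hdc.memLp_of_hasCompactSupport (p := 2) (μ := μ)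
      (hφc.fderiv (𝕜 := ℝ))).restrict Q).norm.integrable_sq
  have hid := integral_integral_norm_sub_sq h2
  have hl := lintegral_lintegral_norm_sub_sq_le (μ := μ) hφ hQ hQc hQD
  have hR : ENNReal.ofReal (D ^ 2) * (2 ^ Module.finrank ℝ E * μ Q *
        ∫⁻ x in Q, ENNReal.ofReal (‖fderiv ℝ φ x‖ ^ 2) ∂μ) =
      ENNReal.ofReal (D ^ 2 * 2 ^ Module.finrank ℝ E * μ.real Q *
        ∫ x in Q, ‖fderiv ℝ φ x‖ ^ 2 ∂μ) := by
    rw [← ofReal_integral_eq_lintegral_ofReal hd2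
      (Filter.Eventually.of_forall fun x => sq_nonneg _), ENNReal.ofReal_mul (by positivity),
      ENNReal.ofReal_mul (by positivity), ENNReal.ofReal_mul (by positivity), measureReal_def,
      ENNReal.ofReal_toReal hQμ, ENNReal.ofReal_pow (by norm_num : (0 : ℝ) ≤ 2)]
    simp only [ENNReal.ofReal_ofNat]
    ring
  have hR0 : 0 ≤ D ^ 2 * 2 ^ Module.finrank ℝ E * μ.real Q *
        ∫ x in Q, ‖fderiv ℝ φ x‖ ^ 2 ∂μ := by positivity
  rw [hR] at hl
  have hL : ∫ x in Q, ∫ y in Q, ‖φ x - φ y‖ ^ 2 ∂μ ∂μ ≤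
      D ^ 2 * 2 ^ Module.finrank ℝ E * μ.real Q * ∫ x in Q, ‖fderiv ℝ φ x‖ ^ 2 ∂μ := by
    have hin : ∀ x, Integrable (fun y => ‖φ x - φ y‖ ^ 2) (μ.restrict Q) := fun x =>
      (((memLp_const (φ x)).sub h2).norm).integrable_sq
    rw [integral_eq_lintegral_of_nonneg_ae
      (Filter.Eventually.of_forall fun x => integral_nonneg fun y => sq_nonneg _)]
    · refine ENNReal.toReal_le_of_le_ofReal hR0 (le_trans (le_of_eq ?_) hl)
      refine lintegral_congr fun x => ?_
      rw [ofReal_integral_eq_lintegral_ofReal (hin x)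
        (Filter.Eventually.of_forall fun y => sq_nonneg _)]
    · have hc := hφ.continuous
      have : StronglyMeasurable fun p : E × E => ‖φ p.1 - φ p.2‖ ^ 2 :=
        Continuous.stronglyMeasurable (by fun_prop)
      exact (this.integral_prod_right').aestronglyMeasurable
  rw [hid, measureReal_restrict_apply_univ] at hL
  have : 0 ≤ D ^ 2 * 2 ^ Module.finrank ℝ E * μ.real Q *
        ∫ x in Q, ‖fderiv ℝ φ x‖ ^ 2 ∂μ := hR0
  linarith

end Poincare

/-! ### Density of test fields and the Friedrichs inequality -/

section TestFields

variable {d : ℕ} {Ω : Set (Pt d)}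

theorem norm_fderiv_le_norm_jacobian (φ : Pt d → Pt d) (x : Pt d) :
    ‖fderiv ℝ φ x‖ ≤ ‖jacobian φ x‖ := by
  refine ContinuousLinearMap.opNorm_le_bound _ (norm_nonneg _) fun v => ?_
  refine le_of_sq_le_sq ?_ (by positivity)
  rw [mul_pow, EuclideanSpace.norm_sq_eq, EuclideanSpace.norm_sq_eq, EuclideanSpace.norm_sq_eq]
  have hv : ∀ i, fderiv ℝ φ x v i = ∑ j, fderiv ℝ φ x (EuclideanSpace.single j 1) i * v j := by
    intro i
    have h := (EuclideanSpace.basisFun (Fin d) ℝ).sum_repr v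
    conv_lhs => rw [← h]
    simp [map_sum, mul_comm]
  rw [Fintype.sum_prod_type, Finset.sum_mul]
  refine Finset.sum_le_sum fun i _ => ?_
  simp only [Real.norm_eq_abs, sq_abs, jacobian]
  rw [hv]
  exact Finset.sum_mul_sq_le_sq_mul_sq _ _ _

theorem jacobian_add {φ ψ : Pt d → Pt d} (hφ : Differentiable ℝ φ) (hψ : Differentiable ℝ ψ)
    (x : Pt d) : jacobian (φ + ψ) x = jacobian φ x + jacobian ψ x := by
  ext ij
  simp [jacobian, fderiv_add (hφ x) (hψ x)]

theorem jacobian_const_smul {φ : Pt d → Pt d} (hφ : Differentiable ℝ φ) (c : ℝ)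
    (x : Pt d) : jacobian (c • φ) x = c • jacobian φ x := by
  ext ij
  simp [jacobian, fderiv_const_smul (hφ x)]

/-- The test pairs already form a subspace, so H¹₀ is the closure of single test fields. -/
theorem mem_testPairs_of_mem_span {w : L2Field Ω × L2Tensor Ω}
    (hw : w ∈ Submodule.span ℝ (testPairs Ω)) : w ∈ testPairs Ω := by
  induction hw using Submodule.span_induction with
  | mem w hw => exact hw
  | zero =>
    refine ⟨0, contDiff_zero_fun, HasCompactSupport.zero, ?_, Lp.coeFn_zero _ _ _, ?_⟩
    · rw [tsupport_eq_empty_iff.2 rfl]; exact Set.empty_subset _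
    · refine (Lp.coeFn_zero _ _ _).trans (Filter.Eventually.of_forall fun x => ?_)
      ext ij
      simp [jacobian]
  | add w z _ _ hw hz =>
    obtain ⟨φ, hφ, hφc, hφΩ, h1, h2⟩ := hw
    obtain ⟨ψ, hψ, hψc, hψΩ, h3, h4⟩ := hz
    refine ⟨φ + ψ, hφ.add hψ, hφc.add hψc,
      (tsupport_add φ ψ).trans (Set.union_subset hφΩ hψΩ), ?_, ?_⟩
    · exact (Lp.coeFn_add _ _).trans (h1.add h3)
    · refine (Lp.coeFn_add _ _).trans ((h2.add h4).trans
        (Filter.Eventually.of_forall fun x => ?_))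
      exact (jacobian_add (hφ.differentiable (by simp)) (hψ.differentiable (by simp)) x).symm
  | smul c w _ hw =>
    obtain ⟨φ, hφ, hφc, hφΩ, h1, h2⟩ := hw
    refine ⟨c • φ, hφ.const_smul c, hφc.smul_left (f := fun _ => c),
      (tsupport_smul_subset_right (fun _ => c) φ).trans hφΩ, ?_, ?_⟩
    · exact (Lp.coeFn_smul _ _).trans (h1.const_smul c)
    · refine (Lp.coeFn_smul _ _).trans ((h2.const_smul c).trans
        (Filter.Eventually.of_forall fun x => ?_))
      exact (jacobian_const_smul (hφ.differentiable (by simp)) c x).symm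

theorem norm_sq_eq_integral {α G : Type*} [MeasurableSpace α] {μ : Measure α}
    [NormedAddCommGroup G] [InnerProductSpace ℝ G] (f : Lp G 2 μ) {φ : α → G}
    (h : (f : α → G) =ᵐ[μ] φ) : ‖f‖ ^ 2 = ∫ x, ‖φ x‖ ^ 2 ∂μ := by
  rw [← real_inner_self_eq_norm_sq, L2.inner_def]
  refine integral_congr_ae ?_
  filter_upwards [h] with x hx
  rw [hx, real_inner_self_eq_norm_sq]

/-- A closed condition on `H¹₀` need only be checked on test fields. -/
theorem mem_of_isClosed_of_testPairs {S : Set (L2Field Ω × L2Tensor Ω)} (hS : IsClosed S)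
    (h : testPairs Ω ⊆ S) (v : VelocitySpace Ω) : v.1 ∈ S :=
  closure_minimal (fun _ hw => h (mem_testPairs_of_mem_span hw)) hS v.2

/-- The smooth vector fields with compact support in `Ω`. -/
structure IsTestField (Ω : Set (Pt d)) (φ : Pt d → Pt d) : Prop where
  contDiff : ContDiff ℝ ∞ φ
  hasCompactSupport : HasCompactSupport φ
  tsupport_subset : tsupport φ ⊆ Ω

namespace IsTestField

variable {φ : Pt d → Pt d}

theorem eq_zero (hφ : IsTestField Ω φ) {x : Pt d} (hx : x ∉ Ω) : φ x = 0 :=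
  image_eq_zero_of_notMem_tsupport fun h => hx (hφ.tsupport_subset h)

theorem fderiv_eq_zero (hφ : IsTestField Ω φ) {x : Pt d} (hx : x ∉ Ω) : fderiv ℝ φ x = 0 :=
  image_eq_zero_of_notMem_tsupport fun h => hx (hφ.tsupport_subset (tsupport_fderiv_subset ℝ h))

theorem contDiff_one (hφ : IsTestField Ω φ) : ContDiff ℝ 1 φ := hφ.contDiff.of_le (by simp)

theorem continuous_fderiv (hφ : IsTestField Ω φ) : Continuous (fderiv ℝ φ) :=
  hφ.contDiff_one.continuous_fderiv one_ne_zero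

theorem integrable_norm_sq (hφ : IsTestField Ω φ) : Integrable (fun x => ‖φ x‖ ^ 2) :=
  ((hφ.contDiff.continuous.memLp_of_hasCompactSupport (p := 2)
    hφ.hasCompactSupport).norm).integrable_sq

theorem integrable_norm_fderiv_sq (hφ : IsTestField Ω φ) :
    Integrable (fun x => ‖fderiv ℝ φ x‖ ^ 2) :=
  ((hφ.continuous_fderiv.memLp_of_hasCompactSupport (p := 2)
    (hφ.hasCompactSupport.fderiv (𝕜 := ℝ))).norm).integrable_sq

theorem setIntegral_norm_sq_eq (hφ : IsTestField Ω φ) {S : Set (Pt d)} (hS : Ω ⊆ S) :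
    ∫ x in S, ‖φ x‖ ^ 2 = ∫ x, ‖φ x‖ ^ 2 :=
  setIntegral_eq_integral_of_forall_compl_eq_zero fun x hx => by
    rw [hφ.eq_zero fun h => hx (hS h)]; simp

theorem setIntegral_inter_eq (hφ : IsTestField Ω φ) {S : Set (Pt d)} (hS : MeasurableSet S) :
    ∫ x in S, φ x ∂(volume.restrict Ω) = ∫ x in S, φ x := by
  rw [Measure.restrict_restrict hS]
  exact (setIntegral_eq_of_subset_of_forall_sdiff_eq_zero hS Set.inter_subset_left
    fun x hx => hφ.eq_zero fun h => hx.2 ⟨hx.1, h⟩).symm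

end IsTestField

/-- The properties of a test pair that enter the Poincaré inequalities. -/
theorem exists_isTestField {w : L2Field Ω × L2Tensor Ω} (hw : w ∈ testPairs Ω) :
    ∃ φ : Pt d → Pt d, IsTestField Ω φ ∧ ‖w.1‖ ^ 2 = ∫ x, ‖φ x‖ ^ 2 ∧
      ∫ x, ‖fderiv ℝ φ x‖ ^ 2 ≤ ‖w.2‖ ^ 2 ∧
      ∀ S, MeasurableSet S → ∫ x in S, w.1 x ∂(volume.restrict Ω) = ∫ x in S, φ x := by
  obtain ⟨φ, h1, h2, h3, h4, h5⟩ := hw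
  have hφ : IsTestField Ω φ := ⟨h1, h2, h3⟩
  refine ⟨φ, hφ, ?_, ?_, ?_⟩
  · rw [norm_sq_eq_integral _ h4, hφ.setIntegral_norm_sq_eq subset_rfl]
  · rw [norm_sq_eq_integral _ h5, ← setIntegral_eq_integral_of_forall_compl_eq_zero (s := Ω)
      fun x hx => by rw [hφ.fderiv_eq_zero hx]; simp]
    refine integral_mono hφ.integrable_norm_fderiv_sq.integrableOn ?_ fun x => ?_
    · exact ((memLp_congr_ae h5).1 (Lp.memLp w.2)).norm.integrable_sq
    · exact pow_le_pow_left₀ (norm_nonneg _) (norm_fderiv_le_norm_jacobian φ x) 2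
  · intro S hS
    rw [← hφ.setIntegral_inter_eq hS]
    exact integral_congr_ae (ae_restrict_of_ae h4)

/-- The Friedrichs inequality on a bounded open set. -/
theorem exists_norm_val_sq_le (hd : 0 < d) (hb : Bornology.IsBounded Ω) :
    ∃ C : ℝ, 0 < C ∧ ∀ v : VelocitySpace Ω, ‖val v‖ ^ 2 ≤ C * ‖grad v‖ ^ 2 := by
  obtain ⟨R, hR0, hR⟩ : ∃ R : ℝ, 0 < R ∧ Ω ⊆ Metric.ball 0 R := by
    obtain ⟨R, hR⟩ := hb.subset_ball 0
    exact ⟨max R 1, by positivity, hR.trans (Metric.ball_subset_ball (le_max_left _ _))⟩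
  have : Nonempty (Fin d) := ⟨⟨0, hd⟩⟩
  -- Doubling the radius gives |Ω| ≤ |Q|/2, so the mean term of Poincaré–Wirtinger is at most half
  -- of the left side and is absorbed.
  set Q := Metric.ball (0 : Pt d) (2 * R) with hQdef
  have hΩQ : Ω ⊆ Q := hR.trans (Metric.ball_subset_ball (by linarith))
  set C := 2 * ((4 * R) ^ 2 * 2 ^ Module.finrank ℝ (Pt d)) with hC
  have hC0 : 0 < C := by positivity
  have hQtop : volume Q ≠ ⊤ := measure_ball_lt_top.ne
  have hQ0 : 0 < volume.real Q :=
    ENNReal.toReal_pos (Metric.measure_ball_pos _ _ (by positivity)).ne' hQtop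
  have hΩvol : 2 * volume.real Ω ≤ volume.real Q := by
    have h1 : volume.real Ω ≤ volume.real (Metric.ball (0 : Pt d) R) :=
      measureReal_mono hR measure_ball_lt_top.ne
    have h2 : volume.real Q = 2 ^ Module.finrank ℝ (Pt d) *
        volume.real (Metric.ball (0 : Pt d) R) := by
      rw [hQdef, measureReal_def, measureReal_def,
        Measure.addHaar_ball_mul volume (0 : Pt d) zero_le_two R, ENNReal.toReal_mul,
        ENNReal.toReal_ofReal (by positivity)]
    have h3 : (2 : ℝ) ≤ 2 ^ Module.finrank ℝ (Pt d) := by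
      rw [finrank_euclideanSpace_fin]
      exact le_self_pow₀ one_le_two hd.ne'
    rw [h2]
    nlinarith [measureReal_nonneg (μ := volume) (s := Metric.ball (0 : Pt d) R)]
  refine ⟨C, hC0, fun v => ?_⟩
  refine mem_of_isClosed_of_testPairs (S := {w | ‖w.1‖ ^ 2 ≤ C * ‖w.2‖ ^ 2})
    (isClosed_le (by fun_prop) (by fun_prop)) (fun w hw => ?_) v
  obtain ⟨φ, hφ, h1, h2, -⟩ := exists_isTestField hw
  change ‖w.1‖ ^ 2 ≤ C * ‖w.2‖ ^ 2
  have hP := measureReal_mul_integral_norm_sq_le (μ := volume) hφ.contDiff_one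
    hφ.hasCompactSupport (D := 4 * R) (Q := Q) measurableSet_ball (convex_ball _ _) hQtop
    (fun x hx y hy => by
      rw [hQdef, mem_ball_zero_iff] at hx hy
      exact (norm_sub_le x y).trans (by linarith))
  rw [hφ.setIntegral_norm_sq_eq hΩQ] at hP
  have hmean : ‖∫ x in Q, φ x‖ ^ 2 ≤ volume.real Ω * ∫ x, ‖φ x‖ ^ 2 := by
    have : IsFiniteMeasure (volume.restrict Ω) :=
      ⟨by simpa using (measure_mono hΩQ).trans_lt hQtop.lt_top⟩
    have h3 := integral_integral_norm_sub_sq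
      ((hφ.contDiff.continuous.memLp_of_hasCompactSupport (p := 2) (μ := volume)
        hφ.hasCompactSupport).restrict Ω)
    have h4 : 0 ≤ ∫ x in Ω, ∫ y in Ω, ‖φ x - φ y‖ ^ 2 :=
      integral_nonneg fun x => integral_nonneg fun y => sq_nonneg _
    rw [h3, measureReal_restrict_apply_univ, hφ.setIntegral_norm_sq_eq subset_rfl] at h4
    have h5 : ∫ x in Q, φ x = ∫ x in Ω, φ x :=
      setIntegral_eq_of_subset_of_forall_sdiff_eq_zero measurableSet_ball hΩQ
        fun x hx => hφ.eq_zero hx.2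
    rw [h5]
    linarith
  have hI : 0 ≤ ∫ x, ‖φ x‖ ^ 2 := integral_nonneg fun x => sq_nonneg _
  have hDQ : ∫ x in Q, ‖fderiv ℝ φ x‖ ^ 2 ≤ ‖w.2‖ ^ 2 :=
    (setIntegral_le_integral hφ.integrable_norm_fderiv_sq
      (Filter.Eventually.of_forall fun x => sq_nonneg _)).trans h2
  have hmul : volume.real Ω * ∫ x, ‖φ x‖ ^ 2 ≤ volume.real Q / 2 * ∫ x, ‖φ x‖ ^ 2 :=
    mul_le_mul_of_nonneg_right (by linarith) hI
  have hmul2 := mul_le_mul_of_nonneg_left hDQ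
    (show 0 ≤ (4 * R) ^ 2 * 2 ^ Module.finrank ℝ (Pt d) * volume.real Q by positivity)
  rw [h1]
  refine le_of_mul_le_mul_left ?_ hQ0
  rw [hC]
  linarith

end TestFields

/-! ### Grid of cubes -/

section Cells

variable {d : ℕ}

/-- The half-open cube of side `δ` with corner `δ k`. -/
def gridCell (δ : ℝ) (k : Fin d → ℤ) : Set (Pt d) :=
  {x | ∀ i, x i ∈ Set.Ico (k i * δ) ((k i + 1) * δ)}

theorem gridCell_eq_iInter (δ : ℝ) (k : Fin d → ℤ) :
    gridCell δ k = ⋂ i, (fun x : Pt d => x i) ⁻¹' Set.Ico (k i * δ) ((k i + 1) * δ) := by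
  ext x; simp [gridCell]

theorem measurableSet_gridCell (δ : ℝ) (k : Fin d → ℤ) : MeasurableSet (gridCell δ k) := by
  rw [gridCell_eq_iInter]
  exact MeasurableSet.iInter fun i => measurableSet_Ico.preimage (by fun_prop)

theorem convex_gridCell (δ : ℝ) (k : Fin d → ℤ) : Convex ℝ (gridCell δ k) := by
  rw [gridCell_eq_iInter]
  refine convex_iInter fun i => (convex_Ico _ _).is_linear_preimage ⟨fun x y => ?_, fun c x => ?_⟩
  · simp
  · simp

theorem norm_sub_le_of_mem_gridCell {δ : ℝ} (hδ : 0 < δ) {k : Fin d → ℤ} {x y : Pt d}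
    (hx : x ∈ gridCell δ k) (hy : y ∈ gridCell δ k) : ‖x - y‖ ≤ √d * δ := by
  refine le_of_sq_le_sq ?_ (by positivity)
  rw [EuclideanSpace.norm_sq_eq, mul_pow, Real.sq_sqrt (Nat.cast_nonneg d)]
  have h : ∀ i ∈ Finset.univ, ‖(x - y) i‖ ^ 2 ≤ δ ^ 2 := by
    intro i _
    have h1 := hx i
    have h2 := hy i
    rw [Set.mem_Ico] at h1 h2
    rw [Real.norm_eq_abs, sq_abs, PiLp.sub_apply]
    exact sq_le_sq' (by linarith) (by linarith)
  simpa using Finset.sum_le_card_nsmul _ _ _ h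

theorem mem_gridCell_iff {δ : ℝ} (hδ : 0 < δ) {k : Fin d → ℤ} {x : Pt d} :
    x ∈ gridCell δ k ↔ ∀ i, ⌊x i / δ⌋ = k i := by
  refine forall_congr' fun i => ?_
  rw [Int.floor_eq_iff, Set.mem_Ico, le_div_iff₀ hδ, div_lt_iff₀ hδ]

theorem pairwise_disjoint_gridCell {δ : ℝ} (hδ : 0 < δ) :
    Pairwise (Function.onFun Disjoint (gridCell (d := d) δ)) := by
  intro k l hkl
  refine Set.disjoint_left.2 fun x hx hy => hkl (funext fun i => ?_)
  rw [mem_gridCell_iff hδ] at hx hy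
  rw [← hx i, hy i]

theorem exists_finset_gridCell_cover {δ : ℝ} (hδ : 0 < δ) {Ω : Set (Pt d)}
    (hb : Bornology.IsBounded Ω) :
    ∃ s : Finset (Fin d → ℤ), Ω ⊆ ⋃ k ∈ s, gridCell δ k := by
  obtain ⟨R, hR⟩ := hb.subset_closedBall 0
  refine ⟨Fintype.piFinset fun _ => Finset.Icc ⌊-R / δ⌋ ⌊R / δ⌋, fun x hx => ?_⟩
  refine Set.mem_iUnion₂.2 ⟨fun i => ⌊x i / δ⌋, ?_, (mem_gridCell_iff hδ).2 fun i => rfl⟩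
  rw [Fintype.mem_piFinset]
  intro i
  have h1 : |x i| ≤ R :=
    (PiLp.norm_apply_le x i).trans (by simpa using hR hx)
  rw [Finset.mem_Icc]
  exact ⟨Int.floor_le_floor (div_le_div_of_nonneg_right (by linarith [(abs_le.1 h1).1]) hδ.le),
    Int.floor_le_floor (div_le_div_of_nonneg_right (abs_le.1 h1).2 hδ.le)⟩

theorem volume_gridCell_ne_top {δ : ℝ} (hδ : 0 < δ) (k : Fin d → ℤ) :
    volume (gridCell δ k) ≠ ⊤ := by
  have : Bornology.IsBounded (gridCell δ k) := Metric.isBounded_iff.2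
    ⟨√d * δ, fun x hx y hy => by rw [dist_eq_norm]; exact norm_sub_le_of_mem_gridCell hδ hx hy⟩
  exact this.measure_lt_top.ne

end Cells

/-! ### Compactness through cell averages -/

section Compactness

variable {d : ℕ} {Ω : Set (Pt d)}

/-- A quantitative form of the compactness of `H¹₀ → L²`. -/
theorem exists_functionals_norm_val_sq_le (hb : Bornology.IsBounded Ω)
    {ε : ℝ} (hε : 0 < ε) :
    ∃ (s : Finset (Fin d → ℤ)) (g : s → Fin d → L2Field Ω) (c : s → ℝ),
      ∀ v : VelocitySpace Ω, ‖val v‖ ^ 2 ≤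
        ∑ k, c k * ∑ i, inner ℝ (g k i) (val v) ^ 2 + ε * ‖grad v‖ ^ 2 := by
  obtain ⟨δ, hδ, hδε⟩ : ∃ δ : ℝ, 0 < δ ∧
      (√d * δ) ^ 2 * 2 ^ Module.finrank ℝ (Pt d) ≤ ε := by
    set B : ℝ := d * 2 ^ Module.finrank ℝ (Pt d) with hB
    have hB0 : 0 ≤ B := by positivity
    refine ⟨√(ε / (B + 1)), Real.sqrt_pos.2 (by positivity), ?_⟩
    rw [mul_pow, Real.sq_sqrt (Nat.cast_nonneg d), Real.sq_sqrt (by positivity),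
      mul_right_comm, ← hB, mul_div_assoc', div_le_iff₀ (by positivity)]
    nlinarith
  obtain ⟨s, hs⟩ := exists_finset_gridCell_cover (d := d) hδ hb
  have hfin : ∀ k : Fin d → ℤ, (volume.restrict Ω) (gridCell δ k) ≠ ⊤ := fun k =>
    ((Measure.restrict_apply_le _ _).trans_lt (volume_gridCell_ne_top hδ k).lt_top).ne
  -- The functionals are the components of the integrals over the cells; the remainder is
  -- Poincaré–Wirtinger on each small cell.
  refine ⟨s, fun k i => indicatorConstLp 2 (measurableSet_gridCell δ k.1) (hfin k)
    (EuclideanSpace.single i 1), fun k => (volume.real (gridCell δ k.1))⁻¹, fun v => ?_⟩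
  refine mem_of_isClosed_of_testPairs (S := {w | ‖w.1‖ ^ 2 ≤ ∑ k : s,
    (volume.real (gridCell δ k.1))⁻¹ * ∑ i, inner ℝ (indicatorConstLp 2
      (measurableSet_gridCell δ k.1) (hfin k) (EuclideanSpace.single i 1)) w.1 ^ 2 +
    ε * ‖w.2‖ ^ 2}) (isClosed_le (by fun_prop) (by fun_prop)) (fun w hw => ?_) v
  obtain ⟨φ, hφ, h1, h2, h3⟩ := exists_isTestField hw
  have hin : ∀ k : s, ∑ i, inner ℝ (indicatorConstLp 2
      (measurableSet_gridCell δ k.1) (hfin k) (EuclideanSpace.single i (1 : ℝ))) w.1 ^ 2 =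
      ‖∫ x in gridCell δ k.1, φ x‖ ^ 2 := by
    intro k
    rw [← h3 _ (measurableSet_gridCell δ k.1), EuclideanSpace.norm_sq_eq]
    refine Finset.sum_congr rfl fun i _ => ?_
    rw [L2.inner_indicatorConstLp_eq_inner_setIntegral, EuclideanSpace.inner_single_left]
    simp
  have hcell : ∀ k : s, ∫ x in gridCell δ k.1, ‖φ x‖ ^ 2 ≤
      (volume.real (gridCell δ k.1))⁻¹ * ‖∫ x in gridCell δ k.1, φ x‖ ^ 2 +
        ε * ∫ x in gridCell δ k.1, ‖fderiv ℝ φ x‖ ^ 2 := by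
    intro k
    have hI : 0 ≤ ∫ x in gridCell δ k.1, ‖fderiv ℝ φ x‖ ^ 2 :=
      integral_nonneg fun x => sq_nonneg _
    -- A null cell contributes nothing, so cell volumes need not be computed.
    rcases (measureReal_nonneg (μ := volume) (s := gridCell δ k.1)).eq_or_lt with h0 | h0
    · have h4 : volume (gridCell δ k.1) = 0 :=
        (ENNReal.toReal_eq_zero_iff _).1 h0.symm |>.resolve_right (volume_gridCell_ne_top hδ _)
      rw [Measure.restrict_eq_zero.2 h4]
      simp
    · have hP := measureReal_mul_integral_norm_sq_le (μ := volume) hφ.contDiff_one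
        hφ.hasCompactSupport (measurableSet_gridCell δ k.1) (convex_gridCell δ k.1)
        (volume_gridCell_ne_top hδ _)
        (fun x hx y hy => norm_sub_le_of_mem_gridCell hδ hx hy)
      refine le_of_mul_le_mul_left (hP.trans ?_) h0
      rw [mul_add, mul_inv_cancel_left₀ h0.ne']
      have := mul_le_mul_of_nonneg_right hδε (mul_nonneg h0.le hI)
      linarith
  have hU : MeasurableSet (⋃ k ∈ s, gridCell (d := d) δ k) :=
    s.measurableSet_biUnion fun k _ => measurableSet_gridCell δ k
  have hsplit : ∀ f : Pt d → ℝ, Integrable f →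
      ∫ x in ⋃ k ∈ s, gridCell δ k, f x = ∑ k : s, ∫ x in gridCell δ k.1, f x := by
    intro f hf
    rw [integral_biUnion_finset s (fun k _ => measurableSet_gridCell δ k)
      (fun k _ l _ hkl => pairwise_disjoint_gridCell hδ hkl) (fun k _ => hf.integrableOn),
      ← Finset.sum_coe_sort]
  change ‖w.1‖ ^ 2 ≤ _
  simp_rw [hin]
  rw [h1, ← hφ.setIntegral_norm_sq_eq hs, hsplit _ hφ.integrable_norm_sq]
  refine (Finset.sum_le_sum fun k _ => hcell k).trans ?_
  rw [Finset.sum_add_distrib, ← Finset.mul_sum, ← hsplit _ hφ.integrable_norm_fderiv_sq]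
  have h5 := (setIntegral_le_integral (s := ⋃ k ∈ s, gridCell (d := d) δ k)
    hφ.integrable_norm_fderiv_sq (Filter.Eventually.of_forall fun x => sq_nonneg _)).trans h2
  have := mul_le_mul_of_nonneg_left h5 hε.le
  linarith

end Compactness

/-! ### Application to the velocity snapshots -/

section Snapshots

variable {d : ℕ} {Ω : Set (Pt d)}

/-- The weak gradient as a linear map. -/
noncomputable def gradLinear (Ω : Set (Pt d)) : VelocitySpace Ω →ₗ[ℝ] L2Tensor Ω :=
  LinearMap.snd ℝ _ _ ∘ₗ (H10 Ω).subtype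

/-- The underlying function as a linear map. -/
noncomputable def valLinear (Ω : Set (Pt d)) : VelocitySpace Ω →ₗ[ℝ] L2Field Ω :=
  LinearMap.fst ℝ _ _ ∘ₗ (H10 Ω).subtype

theorem grad_sum_smul {ι : Type*} (s : Finset ι) (c : ι → ℝ) (v : ι → VelocitySpace Ω) :
    grad (∑ i ∈ s, c i • v i) = ∑ i ∈ s, c i • grad (v i) := by
  change gradLinear Ω _ = ∑ i ∈ s, c i • gradLinear Ω (v i)
  simp

theorem val_sum_smul {ι : Type*} (s : Finset ι) (c : ι → ℝ) (v : ι → VelocitySpace Ω) :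
    val (∑ i ∈ s, c i • v i) = ∑ i ∈ s, c i • val (v i) := by
  change valLinear Ω _ = ∑ i ∈ s, c i • valLinear Ω (v i)
  simp

theorem snapshotGram_apply (ν : ℝ) {Vh : Submodule ℝ (VelocitySpace Ω)} {N : ℕ}
    (φ : Module.Basis (Fin N) ℝ Vh) (u : ℕ → Vh) (r : ℕ) (i j : Fin r) :
    snapshotGram ν φ u r i j = ν * inner ℝ (grad (u i).1) (grad (u j).1) := by
  have h : ∀ i : ℕ, grad (u i).1 = ∑ a, φ.repr (u i) a • grad (φ a).1 := by
    intro i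
    rw [← grad_sum_smul]
    congr 1
    exact (congrArg Subtype.val (φ.sum_repr (u i)).symm).trans
      (by simp only [Submodule.coe_sum, Submodule.coe_smul])
  rw [real_inner_comm, h i, h j, sum_inner, Finset.mul_sum]
  simp only [snapshotGram, Matrix.mul_apply, Finset.sum_mul, Matrix.transpose_apply, coeffMatrix,
    stiffness, Matrix.of_apply, formA, inner_sum, Finset.mul_sum, inner_smul_left,
    inner_smul_right, conj_trivial]
  refine Finset.sum_congr rfl fun b _ => Finset.sum_congr rfl fun a _ => ?_
  ring

/-- Friedrichs makes the quotients bounded above, without which the real supremum would be a default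
value, and forces v to vanish when its gradient does. -/
theorem inner_le_dualNorm_mul (f : L2Field Ω) {C : ℝ}
    (hF : ∀ v : VelocitySpace Ω, ‖val v‖ ^ 2 ≤ C * ‖grad v‖ ^ 2) (v : VelocitySpace Ω) :
    inner ℝ f (val v) ≤ dualNorm f * ‖grad v‖ := by
  have hle : ∀ v : VelocitySpace Ω, ‖val v‖ ≤ √|C| * ‖grad v‖ := by
    intro v
    refine le_of_sq_le_sq ?_ (by positivity)
    rw [mul_pow, Real.sq_sqrt (abs_nonneg C)]
    exact (hF v).trans (mul_le_mul_of_nonneg_right (le_abs_self C) (sq_nonneg _))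
  have hbdd : BddAbove (Set.range fun v : VelocitySpace Ω => inner ℝ f (val v) / normV v) := by
    refine ⟨‖f‖ * √|C|, ?_⟩
    rintro _ ⟨v, rfl⟩
    refine div_le_of_le_mul₀ (norm_nonneg _) (by positivity) ?_
    refine (real_inner_le_norm _ _).trans ?_
    rw [mul_assoc]
    exact mul_le_mul_of_nonneg_left (hle v) (norm_nonneg _)
  rcases (norm_nonneg (grad v)).eq_or_lt with h | h
  · have h0 := hle v
    rw [← h, mul_zero] at h0
    rw [norm_le_zero_iff.1 h0, ← h]
    simp
  · exact (div_le_iff₀ h).1 (le_ciSup hbdd v)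

/-- Few spectral nodes are large: this is where the compactness of `H¹₀ → L²` enters. -/
theorem card_large_nodes_le {ν ε : ℝ} (hν : 0 < ν) {n : ℕ} {θ : Fin n → ℝ}
    (T : (Fin n → ℝ) →ₗ[ℝ] VelocitySpace Ω) (hgrad : ∀ c, ‖grad (T c)‖ ^ 2 = ∑ l, c l ^ 2)
    (hval : ∀ c, ‖val (T c)‖ ^ 2 = ν * ∑ l, θ l * c l ^ 2)
    {s : Finset (Fin d → ℤ)} {g : s → Fin d → L2Field Ω} {a : s → ℝ}
    (hg : ∀ v : VelocitySpace Ω, ‖val v‖ ^ 2 ≤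
        ∑ k, a k * ∑ i, inner ℝ (g k i) (val v) ^ 2 + ν * ε * ‖grad v‖ ^ 2) :
    (Finset.univ.filter fun l => ε < θ l).card ≤ s.card * d := by
  by_contra! hlt
  set B := {l : Fin n // ε < θ l}
  -- With more large nodes than functionals, some nonzero c supported on them is annihilated by all
  -- functionals. Then ∑ θ c² ≤ ε ∑ c², although θ > ε on the support.
  let f : (B → ℝ) →ₗ[ℝ] (s × Fin d → ℝ) :=
    (LinearMap.pi fun q : s × Fin d => (innerₛₗ ℝ (g q.1 q.2)) ∘ₗ valLinear Ω) ∘ₗ T ∘ₗ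
      Function.ExtendByZero.linearMap ℝ (Subtype.val : B → Fin n)
  have hker : LinearMap.ker f ≠ ⊥ := by
    apply LinearMap.ker_ne_bot_of_finrank_lt
    rw [Module.finrank_fintype_fun_eq_card, Module.finrank_fintype_fun_eq_card,
      Fintype.card_subtype]
    simpa using hlt
  obtain ⟨c, hc, hc0⟩ := Submodule.exists_mem_ne_zero_of_ne_bot hker
  set e : Fin n → ℝ := Function.ExtendByZero.linearMap ℝ (Subtype.val : B → Fin n) c with he
  have hzero : ∀ k i, inner ℝ (g k i) (val (T e)) = 0 := fun k i =>
    congrFun (LinearMap.mem_ker.1 hc) (k, i)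
  have heB : ∀ l : B, e l.1 = c l := fun l => Subtype.val_injective.extend_apply c 0 l
  have heB' : ∀ l : Fin n, ¬ ε < θ l → e l = 0 := fun l hl =>
    Function.extend_apply' _ _ _ (by rintro ⟨l', rfl⟩; exact hl l'.2)
  have h := hg (T e)
  simp only [hzero] at h
  rw [hval, hgrad] at h
  simp only [ne_eq, OfNat.ofNat_ne_zero, not_false_eq_true, zero_pow, Finset.sum_const_zero,
    mul_zero, zero_add] at h
  rw [mul_assoc] at h
  have h1 := le_of_mul_le_mul_left h hν
  rw [Finset.mul_sum] at h1
  obtain ⟨l, hl⟩ := Function.ne_iff.1 hc0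
  refine absurd h1 (not_le.2 (Finset.sum_lt_sum (fun l _ => ?_) ⟨l.1, Finset.mem_univ _, ?_⟩))
  · by_cases hl : ε < θ l
    · exact mul_le_mul_of_nonneg_right hl.le (sq_nonneg _)
    · simp [heB' l hl]
  · rw [heB]
    exact mul_lt_mul_of_pos_right l.2 (sq_pos_of_ne_zero hl)

theorem eq_zero_of_grad_eq_zero {C : ℝ}
    (hF : ∀ v : VelocitySpace Ω, ‖val v‖ ^ 2 ≤ C * ‖grad v‖ ^ 2) {v : VelocitySpace Ω}
    (hv : grad v = 0) : v = 0 := by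
  have h := hF v
  rw [hv, norm_zero, zero_pow two_ne_zero, mul_zero] at h
  have h2 : val v = 0 := norm_eq_zero.1 (pow_eq_zero_iff two_ne_zero |>.1
    (le_antisymm h (sq_nonneg _)))
  exact Subtype.ext (Prod.ext h2 hv)

theorem linearIndependent_grad {C : ℝ}
    (hF : ∀ v : VelocitySpace Ω, ‖val v‖ ^ 2 ≤ C * ‖grad v‖ ^ 2)
    {Vh : Submodule ℝ (VelocitySpace Ω)} {r : ℕ} {u : ℕ → Vh}
    (hu : LinearIndependent ℝ fun i : Fin r => u i) :
    LinearIndependent ℝ fun i : Fin r => grad (u i).1 := by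
  refine Fintype.linearIndependent_iff.2 fun c hc => ?_
  have h0 : ∑ i, c i • u i = ∑ i : Fin r, (0 : Fin r → ℝ) i • u i := by
    refine Subtype.ext ?_
    rw [← grad_sum_smul] at hc
    simp only [Submodule.coe_sum, Submodule.coe_smul, Pi.zero_apply, zero_smul,
      Finset.sum_const_zero]
    exact eq_zero_of_grad_eq_zero hF hc
  exact fun i => Fintype.linearIndependent_iffₛ.1 hu c 0 h0 i

/-- The test field u_j is itself discretely divergence-free, so the pressure term vanishes. -/
theorem IsSnapshotSequence.nu_mul_inner_grad {ν : ℝ} {f : L2Field Ω}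
    {Vh : Submodule ℝ (VelocitySpace Ω)} {Qh : Submodule ℝ (PressureSpace Ω)} {ℓ : ℕ}
    {u : ℕ → Vh} {p : ℕ → Qh} (hu : IsSnapshotSequence ν f ℓ u p) {i j : ℕ} (hi : i < ℓ)
    (hj : j < ℓ) :
    ν * inner ℝ (grad (u i).1) (grad (u j).1) = inner ℝ (load f u i) (val (u j).1) := by
  have h := (hu i hi).1 (u j)
  rwa [(hu j hj).2, add_zero] at h

theorem dotProduct_mulVec_snapshotGram (ν : ℝ) {Vh : Submodule ℝ (VelocitySpace Ω)} {N : ℕ}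
    (φ : Module.Basis (Fin N) ℝ Vh) (u : ℕ → Vh) (r : ℕ) (x : Fin r → ℝ) :
    x ⬝ᵥ Matrix.mulVec (snapshotGram ν φ u r) x = ν * ‖∑ i, x i • grad (u i).1‖ ^ 2 := by
  rw [← real_inner_self_eq_norm_sq, sum_inner, Finset.mul_sum]
  simp only [dotProduct, Matrix.mulVec, snapshotGram_apply, inner_sum, inner_smul_left,
    inner_smul_right, Finset.mul_sum, conj_trivial]
  refine Finset.sum_congr rfl fun i _ => Finset.sum_congr rfl fun j _ => ?_
  ring

/-- The spectral measure of a snapshot sequence, with the properties that enter the eigenvalue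
bounds. -/
theorem IsSnapshotSequence.exists_spectral_measure {ν : ℝ} (hν : 0 < ν) {f : L2Field Ω}
    {Vh : Submodule ℝ (VelocitySpace Ω)} {Qh : Submodule ℝ (PressureSpace Ω)} {N : ℕ}
    (φ : Module.Basis (Fin N) ℝ Vh) {ℓ : ℕ}
    {u : ℕ → Vh} {p : ℕ → Qh} (hu : IsSnapshotSequence ν f ℓ u p) {r : ℕ} (hr : 0 < r)
    (hrℓ : r ≤ ℓ) {C : ℝ} (hF : ∀ v : VelocitySpace Ω, ‖val v‖ ^ 2 ≤ C * ‖grad v‖ ^ 2)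
    (hlin : LinearIndependent ℝ fun i : Fin r => u i) :
    ∃ w θ : Fin r → ℝ, (∀ l, 0 ≤ w l) ∧ (∀ l, 0 ≤ θ l) ∧ (∀ l, θ l ≤ C / ν) ∧
      (∀ i j : Fin r, snapshotGram ν φ u r i j = ∑ l, w l * θ l ^ ((i : ℕ) + j)) ∧
      ∑ l, w l ≤ dualNorm f ^ 2 / ν ∧
      ∃ T : (Fin r → ℝ) →ₗ[ℝ] VelocitySpace Ω, (∀ c, ‖grad (T c)‖ ^ 2 = ∑ l, c l ^ 2) ∧
        ∀ c, ‖val (T c)‖ ^ 2 = ν * ∑ l, θ l * c l ^ 2 := by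
  obtain ⟨w, θ, hw, hθ, hKw, T, hT⟩ := StokesROM.exists_spectral_measure hν hr
    (fun i => grad (u i).1) (fun i => val (u i).1) (linearIndependent_grad hF hlin)
    (fun i j hi hj => hu.nu_mul_inner_grad (i := i + 1) (j := j) (by omega) (by omega))
  have hT' : ∀ c, (Fintype.linearCombination ℝ (fun i : Fin r => (u i).1) ∘ₗ T) c =
      ∑ i, T c i • (u i).1 := fun c =>
    Fintype.linearCombination_apply ℝ (fun i : Fin r => (u i).1) (T c)
  have hgrad : ∀ c, ‖grad ((Fintype.linearCombination ℝ (fun i : Fin r => (u i).1) ∘ₗ T) c)‖ ^ 2 =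
      ∑ l, c l ^ 2 := fun c => by
    rw [hT', grad_sum_smul]; exact (hT c).1
  have hval : ∀ c, ‖val ((Fintype.linearCombination ℝ (fun i : Fin r => (u i).1) ∘ₗ T) c)‖ ^ 2 =
      ν * ∑ l, θ l * c l ^ 2 := fun c => by
    rw [hT', val_sum_smul]; exact (hT c).2
  refine ⟨w, θ, hw, hθ, fun l => ?_, fun i j => (snapshotGram_apply ν φ u r i j).trans (hKw i j),
    ?_, _, hgrad, hval⟩
  -- Friedrichs at the normalised l-th eigenvector reads νθ_l ≤ C.
  · have h := hF ((Fintype.linearCombination ℝ (fun i : Fin r => (u i).1) ∘ₗ T) (Pi.single l 1))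
    rw [hgrad, hval] at h
    have e1 : ∑ l', θ l' * (Pi.single l (1 : ℝ) : Fin r → ℝ) l' ^ 2 = θ l := by
      simp [Pi.single_apply]
    have e2 : ∑ l', (Pi.single l (1 : ℝ) : Fin r → ℝ) l' ^ 2 = 1 := by
      simp [Pi.single_apply]
    rw [e1, e2, mul_one] at h
    exact (le_div_iff₀' hν).2 h
  -- The total mass is the zeroth moment K_00 = (f, u_0), the energy of the first snapshot.
  · have h1 : ν * inner ℝ (grad (u 0).1) (grad (u 0).1) = ∑ l, w l := by
      have := hKw ⟨0, hr⟩ ⟨0, hr⟩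
      simpa only [add_zero, pow_zero, mul_one] using this
    have h2 : ν * inner ℝ (grad (u 0).1) (grad (u 0).1) = inner ℝ f (val (u 0).1) :=
      hu.nu_mul_inner_grad (i := 0) (j := 0) (by omega) (by omega)
    have h3 := inner_le_dualNorm_mul f hF (u 0).1
    rw [← h2, real_inner_self_eq_norm_sq] at h3
    rw [← h1, real_inner_self_eq_norm_sq, le_div_iff₀ hν]
    set t := ‖grad (u 0).1‖
    nlinarith [sq_nonneg (dualNorm f - ν * t)]

end Snapshots

end StokesROM

theorem theorem4p1 (d : ℕ) (hd : d = 2 ∨ d = 3) (Ω : Set (StokesROM.Pt d))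
    (hΩo : IsOpen Ω) (hΩb : Bornology.IsBounded Ω) (ν : ℝ) (hν : 0 < ν) :
    ∃ C : ℝ, 0 < C ∧
      ∀ (f : StokesROM.L2Field Ω)
        (Vh : Submodule ℝ (StokesROM.VelocitySpace Ω))
        (Qh : Submodule ℝ (StokesROM.PressureSpace Ω)) (_ : FiniteDimensional ℝ Qh)
        (_ : StokesROM.DiscreteInfSup Vh Qh)
        (N : ℕ) (φ : Module.Basis (Fin N) ℝ Vh)
        (ℓ : ℕ) (u : ℕ → Vh) (p : ℕ → Qh) (_ : StokesROM.IsSnapshotSequence ν f ℓ u p)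
        (r : ℕ) (hr : 1 ≤ r) (_ : r ≤ ℓ) (_ : LinearIndependent ℝ (fun i : Fin r => u i)),
        (∀ i j i' j' : Fin r, (i : ℕ) + j = i' + j' →
          StokesROM.snapshotGram ν φ u r i j = StokesROM.snapshotGram ν φ u r i' j') ∧
        ∃ hK : (StokesROM.snapshotGram ν φ u r).IsHermitian,
          0 < StokesROM.sortedEigenvalue hK ⟨r - 1, by omega⟩ ∧
          (∀ (k : ℕ) (hk : 2 * k + 1 ≤ r),
            StokesROM.sortedEigenvalue hK ⟨2 * k, by omega⟩ ≤
              16 * Real.exp (Real.pi ^ 2 / (4 * Real.log (8 * ((r / 2 : ℕ) : ℝ) / Real.pi)))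
                    ^ (-2 * (k : ℤ) + 2) *
                StokesROM.sortedEigenvalue hK ⟨0, by omega⟩) ∧
          StokesROM.sortedEigenvalue hK ⟨r - 1, by omega⟩ ≤
            C * (2 * (r : ℝ) - 1) * StokesROM.dualNorm f ^ 2 *
              Real.exp (-(7 * ((r : ℝ) + 1) / 2)) := by
  open StokesROM in
  obtain ⟨CF, hCF, hF⟩ := exists_norm_val_sq_le (Ω := Ω) (by omega) hΩb
  obtain ⟨s, g, a, hg⟩ := exists_functionals_norm_val_sq_le (Ω := Ω) hΩb
    (show 0 < ν * Real.exp (-(7 / 4)) by positivity)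
  set L := max 1 (CF / ν) with hL
  set m := s.card * d with hm
  have hL1 : 1 ≤ L := le_max_left _ _
  -- Built only from the Friedrichs constant, the number of compactness functionals and ν, all fixed
  -- before f and the discrete spaces.
  refine ⟨Real.exp (7 * (m + 2) / 2) * L ^ (2 * m) / ν, by positivity, ?_⟩
  intro f Vh Qh _ _ N φ ℓ u p hu r hr hrℓ hlin
  obtain ⟨w, θ, hw, hθ, hθC, hKw', hmass, T, hgrad, hval⟩ :=
    hu.exists_spectral_measure hν φ hr hrℓ hF hlin
  have hK : (snapshotGram ν φ u r).IsHermitian := by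
    refine Matrix.IsHermitian.ext fun i j => ?_
    rw [hKw', hKw', add_comm]
    simp
  have hpos : ∀ x ≠ 0, 0 < x ⬝ᵥ Matrix.mulVec (snapshotGram ν φ u r) x := by
    intro x hx0
    rw [dotProduct_mulVec_snapshotGram]
    have h2 : ∑ i, x i • grad (u i).1 ≠ 0 := fun h =>
      hx0 (funext (Fintype.linearIndependent_iff.1 (linearIndependent_grad hF hlin) x h))
    positivity
  refine ⟨fun i j i' j' hij => by rw [hKw', hKw', hij], hK, sortedEigenvalue_pos hK hpos _,
    fun k hk => sortedEigenvalue_hankel_le hK hr hKw' hw hθ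
      (sortedEigenvalue_pos hK hpos _).le k hk, ?_⟩
  have hlast := sortedEigenvalue_last_le_exp hK hr hKw' hw hθ hL1
    (fun l => (hθC l).trans (le_max_right _ _)) (card_large_nodes_le hν T hgrad hval hg)
  rw [← hm] at hlast
  refine hlast.trans ((mul_le_mul_of_nonneg_left hmass (by positivity)).trans ?_)
  -- The bound already holds without the factor 2r - 1, which only weakens it.
  have hr1 : (1 : ℝ) ≤ 2 * r - 1 := by
    have : (1 : ℝ) ≤ r := by exact_mod_cast hr
    linarith
  have hX : 0 ≤ Real.exp (7 * (m + 2) / 2) * L ^ (2 * m) / ν * dualNorm f ^ 2 *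
      Real.exp (-(7 * ((r : ℝ) + 1) / 2)) := by positivity
  calc _ = Real.exp (7 * (m + 2) / 2) * L ^ (2 * m) / ν * dualNorm f ^ 2 *
      Real.exp (-(7 * ((r : ℝ) + 1) / 2)) := by field_simp
    _ ≤ _ := le_mul_of_one_le_right hX hr1
    _ = _ := by ring
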